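/- **Setting.** Let $\mathcal G$ be a causal diagram: a finite set $\mathbf V$ of nodes, split into observed nodes $\mathbf O$ and latent nodes $\mathbf L$, with directed edges $\to$ and bidirected edges $\leftrightarrow$. Fix a temporal order, i.e. an enumeration of $\mathbf V$ in which every directed edge points forward (so $\mathcal G$ has no directed cycle). Let $\mathbf X=\{X_1,\dots,X_k\}\subseteq\mathbf O$ be actions listed in temporal order, let $Y\in\mathbf V$, and let $\mathbf Z_i\subseteq\mathbf O$ ($i=1,\dots,k$) consist of observed nodes that strictly precede $X_i$. A path (without repeated nodes) is *active given* $\mathbf W$ if each collider on it lies in $\mathrm{An}(\mathbf W)$ (the nodes with a possibly trivial directed path into $\mathbf W$) and no other node of it, endpoints included, lies in $\mathbf W$; $(A\perp B\mid\mathbf W)$ holds in a diagram if it has no path from $A$ to $B$ that is active given $\mathbf W$. Let $\mathcal G'_i$ be obtained from $\mathcal G$ by removing all arrows into $X_{i+1},\dots,X_k$ (bidirected ones included) and then adding the arrows $\mathbf Z_j\to X_j$ for $j>i$; let $(\mathcal G'_i)_{\underline{X_i}}$ be $\mathcal G'_i$ without the directed edges out of $X_i$. The sets $\mathbf Z_1,\dots,\mathbf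 Z_k$ satisfy the *sequential $\pi$-backdoor criterion* for $(\mathcal G,\mathbf X,Y)$ if for each $i$ either (1) $(X_i\perp Y\mid\mathbf Z_i)$ in $(\mathcal G'_i)_{\underline{X_i}}$, or (2) $X_i\notin\mathrm{An}(Y)$ in $\mathcal G'_i$. A structural causal model (SCM) $M$ on $\mathbf V$ has finitely many mutually independent exogenous variables and assigns each $V\in\mathbf V$ by a measurable function of endogenous arguments $\mathrm{PA}_V\subseteq\mathbf V$ and exogenous arguments $\mathbf U_V$; all variables take values in standard Borel spaces. It is *compatible* with $\mathcal G$ if $\mathrm{PA}_V$ is the set of parents of $V$ in $\mathcal G$ for every $V$, and, for $V\ne V'$, $V\leftrightarrow V'$ is in $\mathcal G$ if and only if $\mathbf U_V\cap\mathbf U_{V'}\neq\emptyset$ (a function may depend trivially on an argument). $P(\mathbf O)$ is its observational distribution. A policy $\pi$ consists of Markov kernels $\pi_i(X_i\mid\mathbf Z'_i)$ for some sets $\mathbf Z'_i$ of observed nodes preceding $X_i$; $P(\cdot\mid do(\pi))$ is the law obtained by drawing each $X_i$ from $\pi_i$ instead of assigning it by its structural function. $Y$ is *imitable* with respect to $\mathbf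 X$ in $\mathcal G$ if for all domains of the observed variables and every probability distribution $\rho$ of $\mathbf O$ there is a policy $\pi$ such that $P_M(Y\mid do(\pi))=P_M(Y)$ for every SCM $M$ compatible with $\mathcal G$ with $P_M(\mathbf O)=\rho$. **Theorem.** Suppose $\mathbf Z_1,\dots,\mathbf Z_k$ satisfy the sequential $\pi$-backdoor criterion for $(\mathcal G,\mathbf X,Y)$. Then $Y$ is imitable with respect to $\mathbf X$ in $\mathcal G$. An imitating policy is $\pi_i(X_i\mid\mathbf Z_i)=P(X_i\mid\mathbf Z_i)$ for each action: for every probability distribution $\rho$ of $\mathbf O$, Markov-kernel versions $\pi_i$ of the conditional distributions $\rho(X_i\mid\mathbf Z_i)$ exist, and for every choice of such versions $P_M(Y\mid do(\pi))=P_M(Y)$ holds in every SCM $M$ compatible with $\mathcal G$ with $P_M(\mathbf O)=\rho$. -/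

import Mathlib

open MeasureTheory ProbabilityTheory

noncomputable section

namespace CausalImitation

/-! ### Causal diagrams, ancestors and d-separation -/

/-- A causal diagram on a set `V` of nodes: directed edges `a → b` and bidirected edges `a ↔ b`. -/
structure CausalDiagram (V : Type*) where
  dir : V → V → Prop
  bi : V → V → Prop
  bi_symm : ∀ a b, bi a b → bi b a

/-- The three ways an edge between consecutive nodes `a`, `b` of a path can look:
`a → b`, `a ← b`, `a ↔ b`. -/
inductive EdgeKind
  | right
  | left
  | both

namespace EdgeKind

/-- The edge has an arrowhead at its first node. -/
def HeadAtStart : EdgeKind → Prop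
  | right => False
  | left => True
  | both => True

/-- The edge has an arrowhead at its second node. -/
def HeadAtEnd : EdgeKind → Prop
  | right => True
  | left => False
  | both => True

end EdgeKind

namespace CausalDiagram

variable {V : Type*}

/-- `G` contains an edge of the given kind between `a` and `b`. -/
def HasEdge (G : CausalDiagram V) (a : V) (k : EdgeKind) (b : V) : Prop :=
  match k with
  | EdgeKind.right => G.dir a b
  | EdgeKind.left => G.dir b a
  | EdgeKind.both => G.bi a b

/-- `An(W)`: all nodes with a (possibly trivial) directed path into `W`. -/
def An (G : CausalDiagram V) (W : Set V) : Set V :=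
  {a | ∃ w ∈ W, Relation.ReflTransGen G.dir a w}

/-- There is a path (no repeated nodes) `v 0, …, v m` from `a` to `b` that is active given `W`:
colliders lie in `An(W)`, and all other nodes of the path, endpoints included, lie outside `W`. -/
def HasActivePath (G : CausalDiagram V) (W : Set V) (a b : V) : Prop :=
  ∃ (m : ℕ) (v : ℕ → V) (k : ℕ → EdgeKind),
    v 0 = a ∧ v m = b ∧ Set.InjOn v (Set.Iic m) ∧
    (∀ i < m, G.HasEdge (v i) (k i) (v (i + 1))) ∧
    (∀ i ≤ m,
      ((0 < i ∧ i < m ∧ (k (i - 1)).HeadAtEnd ∧ (k i).HeadAtStart) ∧ v i ∈ G.An W) ∨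
      (¬ (0 < i ∧ i < m ∧ (k (i - 1)).HeadAtEnd ∧ (k i).HeadAtStart) ∧ v i ∉ W))

/-- `(a ⊥ b | W)` in `G`. -/
def DSep (G : CausalDiagram V) (a b : V) (W : Set V) : Prop :=
  ¬ G.HasActivePath W a b

/-- The diagram with all directed edges out of `x` removed. -/
def removeOut (G : CausalDiagram V) (x : V) : CausalDiagram V where
  dir a b := a ≠ x ∧ G.dir a b
  bi := G.bi
  bi_symm := G.bi_symm

/-- A temporal ordering: an enumeration of the nodes in which every arrow points forward. -/
def IsTemporalOrder (G : CausalDiagram V) {n : ℕ} (τ : V ≃ Fin n) : Prop :=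
  ∀ a b, G.dir a b → τ a < τ b

end CausalDiagram

/-! ### The sequential π-backdoor criterion

The nodes are `O ⊕ L`: the observed variables are `Sum.inl o`, the latent ones `Sum.inr l`. -/

section Criterion

variable {O L : Type*} {n : ℕ}

/-- `w` is an action of `X` that comes strictly after `x` in the temporal order. -/
def IsLaterAction (τ : O ⊕ L ≃ Fin n) (X : Finset O) (x : O) (w : O ⊕ L) : Prop :=
  ∃ x' ∈ X, τ (Sum.inl x) < τ (Sum.inl x') ∧ w = Sum.inl x'

/-- The manipulated diagram at action `x`: all arrows into later actions `x'` (bidirected ones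
included) are removed, then arrows from `Z x'` to each later action `x'` are added. -/
def CausalDiagram.manipulated (G : CausalDiagram (O ⊕ L)) (τ : O ⊕ L ≃ Fin n) (X : Finset O)
    (Z : O → Finset O) (x : O) : CausalDiagram (O ⊕ L) where
  dir a b := (G.dir a b ∧ ¬ IsLaterAction τ X x b) ∨
    ∃ x' ∈ X, τ (Sum.inl x) < τ (Sum.inl x') ∧ b = Sum.inl x' ∧ ∃ z ∈ Z x', a = Sum.inl z
  bi a b := G.bi a b ∧ ¬ IsLaterAction τ X x a ∧ ¬ IsLaterAction τ X x b
  bi_symm a b h := ⟨G.bi_symm a b h.1, h.2.2, h.2.1⟩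

/-- Every covariate of an action strictly precedes that action. -/
def CovariatesBefore (τ : O ⊕ L ≃ Fin n) (X : Finset O) (Z : O → Finset O) : Prop :=
  ∀ x ∈ X, ∀ z ∈ Z x, τ (Sum.inl z) < τ (Sum.inl x)

/-- The sets `Z x`, `x ∈ X`, satisfy the sequential π-backdoor criterion for `(G, X, Y)`. -/
def SeqPiBackdoor (G : CausalDiagram (O ⊕ L)) (τ : O ⊕ L ≃ Fin n) (X : Finset O) (Y : O ⊕ L)
    (Z : O → Finset O) : Prop :=
  CovariatesBefore τ X Z ∧
  ∀ x ∈ X,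
    ((G.manipulated τ X Z x).removeOut (Sum.inl x)).DSep (Sum.inl x) Y (Sum.inl '' (Z x : Set O)) ∨
    (Sum.inl x : O ⊕ L) ∉ (G.manipulated τ X Z x).An {Y}

end Criterion

/-! ### Structural causal models -/

/-- The domain of each endogenous variable, from those of the observed and of the latent ones. -/
def Dom {O L : Type*} (DO : O → Type) (DL : L → Type) : O ⊕ L → Type
  | Sum.inl o => DO o
  | Sum.inr l => DL l

instance Dom.instMeasurableSpace {O L : Type*} (DO : O → Type) (DL : L → Type)
    [mO : ∀ o, MeasurableSpace (DO o)] [mL : ∀ l, MeasurableSpace (DL l)] (v : O ⊕ L) :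
    MeasurableSpace (Dom DO DL v) :=
  match v with
  | Sum.inl o => mO o
  | Sum.inr l => mL l

instance Dom.instNonempty {O L : Type*} (DO : O → Type) (DL : L → Type)
    [nO : ∀ o, Nonempty (DO o)] [nL : ∀ l, Nonempty (DL l)] (v : O ⊕ L) :
    Nonempty (Dom DO DL v) :=
  match v with
  | Sum.inl o => nO o
  | Sum.inr l => nL l

/-- A structural causal model with endogenous variables `O ⊕ L`, in which the observed variables
take values in the given domains `DO`. The exogenous variables are indexed by the finite type `U`
and are mutually independent with laws `P u`; `v` is assigned by the function `f v` of its
endogenous arguments `pa v` and its exogenous arguments `exo v`. -/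
structure SCM (O L : Type*) (DO : O → Type) [∀ o, MeasurableSpace (DO o)] where
  DL : L → Type
  [measDL : ∀ l, MeasurableSpace (DL l)]
  [borelDL : ∀ l, StandardBorelSpace (DL l)]
  [nonemptyDL : ∀ l, Nonempty (DL l)]
  U : Type
  [fintypeU : Fintype U]
  DU : U → Type
  [measDU : ∀ u, MeasurableSpace (DU u)]
  [borelDU : ∀ u, StandardBorelSpace (DU u)]
  P : ∀ u, Measure (DU u)
  [probP : ∀ u, IsProbabilityMeasure (P u)]
  pa : O ⊕ L → Set (O ⊕ L)
  exo : O ⊕ L → Set U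
  f : ∀ v, ((w : pa v) → Dom DO DL w) × ((u : exo v) → DU u) → Dom DO DL v
  measurable_f : ∀ v, Measurable (f v)

attribute [instance] SCM.measDL SCM.borelDL SCM.nonemptyDL SCM.fintypeU SCM.measDU SCM.borelDU
  SCM.probP

/-- Decision rules for the actions `X` with covariates `Z`: for each action a Markov kernel from
the values of its covariates to its own values. -/
structure Policy {O : Type*} (DO : O → Type) [∀ o, MeasurableSpace (DO o)]
    (X : Finset O) (Z : O → Finset O) where
  rule : ∀ x : X, Kernel ((z : Z x) → DO z) (DO x)
  [markov : ∀ x, IsMarkovKernel (rule x)]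

attribute [instance] Policy.markov

/-- Each rule of `π` is (a version of) the conditional distribution of `x` given `Z x` under the
distribution `ρ` of the observed variables, i.e. `π(x | Z x) = ρ(x | Z x)`. -/
def Policy.IsConditionalOf {O : Type*} {DO : O → Type} [∀ o, MeasurableSpace (DO o)]
    {X : Finset O} {Z : O → Finset O} (π : Policy DO X Z) (ρ : Measure ((o : O) → DO o)) : Prop :=
  ∀ x : X, ρ.map (fun d => ((fun z : Z x => d z), d x)) =
    (ρ.map (fun d => fun z : Z x => d z)) ⊗ₘ π.rule x

namespace SCM

variable {O L : Type*} {DO : O → Type} [∀ o, MeasurableSpace (DO o)]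

/-- The values of all exogenous and all endogenous variables. -/
abbrev State (M : SCM O L DO) : Type _ :=
  ((u : M.U) → M.DU u) × ((v : O ⊕ L) → Dom DO M.DL v)

/-- `G` is the causal diagram of `M`: the arrows are the arguments of the structural functions
(which may depend trivially on an argument), and a bidirected edge between two nodes means that an
exogenous variable is an argument of both. -/
def Compatible (M : SCM O L DO) (G : CausalDiagram (O ⊕ L)) : Prop :=
  (∀ v w, w ∈ M.pa v ↔ G.dir w v) ∧
  (∀ v w, v ≠ w → ((M.exo v ∩ M.exo w).Nonempty ↔ G.bi v w))

/-- The mechanism of the model for `v`: deterministic assignment by `f v`. -/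
def mech (M : SCM O L DO) (v : O ⊕ L) : Kernel M.State (Dom DO M.DL v) :=
  Kernel.deterministic
    (fun s => M.f v ((fun w : M.pa v => s.2 w), (fun u : M.exo v => s.1 u)))
    ((M.measurable_f v).comp (by fun_prop))

instance (M : SCM O L DO) (v : O ⊕ L) : IsMarkovKernel (M.mech v) := by
  unfold mech; infer_instance

open Classical in
/-- The mechanisms under `do(π)`: each action `x ∈ X` is drawn by the rule `π.rule x` from the
current values of `Z x`, every other variable keeps its mechanism. -/
def mechDo (M : SCM O L DO) {X : Finset O} {Z : O → Finset O} (π : Policy DO X Z) :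
    ∀ v : O ⊕ L, Kernel M.State (Dom DO M.DL v)
  | Sum.inl x =>
    if h : x ∈ X then
      (π.rule ⟨x, h⟩).comap (fun s : M.State => fun z : Z x => (s.2 (Sum.inl z) : DO z))
        (measurable_pi_lambda _ fun z =>
          (measurable_pi_apply (X := Dom DO M.DL) (Sum.inl (z : O))).comp measurable_snd)
    else M.mech (Sum.inl x)
  | Sum.inr l => M.mech (Sum.inr l)

open Classical in
/-- One sampling step: draw a value for `v` by the kernel `K` from the current state and store it. -/
def step (M : SCM O L DO) (v : O ⊕ L) (K : Kernel M.State (Dom DO M.DL v)) :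
    Kernel M.State M.State :=
  (Kernel.id ×ₖ K).map (fun p => (p.1.1, Function.update p.1.2 v p.2))

/-- The law of the endogenous variables when the exogenous ones are drawn from their product law
and the endogenous ones are then drawn one after the other, in the order `τ`, by the mechanisms
`K`. (The initial values of the endogenous variables are arbitrary: if every mechanism reads only
earlier variables, each value is overwritten before it is read.) -/
def sampleLaw (M : SCM O L DO) [∀ o, Nonempty (DO o)] {n : ℕ} (τ : O ⊕ L ≃ Fin n)
    (K : ∀ v, Kernel M.State (Dom DO M.DL v)) : Measure ((v : O ⊕ L) → Dom DO M.DL v) :=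
  (((List.finRange n).map τ.symm).foldl
    (fun (μ : Measure M.State) v => μ.bind (M.step v (K v)))
    ((Measure.pi M.P).map (fun u => (u, fun _ => Classical.arbitrary _)))).map Prod.snd

/-- `P(V)`. -/
def law (M : SCM O L DO) [∀ o, Nonempty (DO o)] {n : ℕ} (τ : O ⊕ L ≃ Fin n) :
    Measure ((v : O ⊕ L) → Dom DO M.DL v) :=
  M.sampleLaw τ M.mech

/-- `P(V | do(π))`. -/
def lawDo (M : SCM O L DO) [∀ o, Nonempty (DO o)] {n : ℕ} (τ : O ⊕ L ≃ Fin n)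
    {X : Finset O} {Z : O → Finset O} (π : Policy DO X Z) :
    Measure ((v : O ⊕ L) → Dom DO M.DL v) :=
  M.sampleLaw τ (M.mechDo π)

/-- The observational distribution `P(O)`. -/
def obsLaw (M : SCM O L DO) [∀ o, Nonempty (DO o)] {n : ℕ} (τ : O ⊕ L ≃ Fin n) :
    Measure ((o : O) → DO o) :=
  (M.law τ).map (fun d o => (d (Sum.inl o) : DO o))

end SCM

/-! ### Imitability -/

/-- In every model compatible with `G` whose observational distribution is `ρ`, the policy `π`
reproduces the law of `Y`: `P(Y | do(π)) = P(Y)`. -/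
def Policy.Imitates {O L : Type*} {n : ℕ} {DO : O → Type} [∀ o, MeasurableSpace (DO o)]
    [∀ o, Nonempty (DO o)] {X : Finset O} {Z : O → Finset O} (π : Policy DO X Z)
    (G : CausalDiagram (O ⊕ L)) (τ : O ⊕ L ≃ Fin n) (Y : O ⊕ L)
    (ρ : Measure ((o : O) → DO o)) : Prop :=
  ∀ M : SCM O L DO, M.Compatible G → M.obsLaw τ = ρ →
    (M.lawDo τ π).map (fun d => d Y) = (M.law τ).map (fun d => d Y)

/-- `Y` is imitable with respect to the actions `X` in `G`: the observational distribution `ρ`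
alone determines a policy, using observed covariates that precede the actions, which reproduces the
law of `Y` in all models compatible with `G` that have observational distribution `ρ`. -/
def Imitable {O L : Type*} {n : ℕ} (G : CausalDiagram (O ⊕ L)) (τ : O ⊕ L ≃ Fin n)
    (X : Finset O) (Y : O ⊕ L) : Prop :=
  ∀ (DO : O → Type) [∀ o, MeasurableSpace (DO o)] [∀ o, StandardBorelSpace (DO o)]
    [∀ o, Nonempty (DO o)] (ρ : Measure ((o : O) → DO o)) [IsProbabilityMeasure ρ],
    ∃ (Z : O → Finset O) (π : Policy DO X Z), CovariatesBefore τ X Z ∧ π.Imitates G τ Y ρ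

end CausalImitation

end

/-!
The actions are changed from their policy rules to their natural mechanisms one at a time, in
temporal order; it is to be shown that no such exchange alters the law of `Y`
(`SCM.hybridProb_zero_eq_last`). At the exchange of an action `x`, all earlier nodes have their
natural mechanisms, so they are deterministic functions of the exogenous variables, and the later
actions follow the policy, which is the situation described by the diagram manipulated at `x`.

If `x` is not an ancestor of `Y` in that diagram, the rest of the sampling does not read `x` in
determining `Y`. Otherwise the covariates `W` of `x` separate `x` from `Y` once the edges out of `x`
are removed. Then the ancestors of `x`, `Y` and `W` split into a part containing `x` and a part
containing `Y` that are joined by no edges except through `W` (`CausalDiagram.DSep.exists_split`,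
by following active walks from `x`). In particular the two parts use disjoint sets of exogenous
variables. They thus behave like two parties with independent private randomness who take turns in
publishing the values of `W`, each being a function of the private randomness of one party and of
what has been published before. As in communication complexity, the private randomness of the two
parties remains independent given the published transcript
(`SCM.sigmaCondIndep_of_reads`, by repeated use of `SigmaCondIndep.weak_union`).

Now `x` is computed by the first party, and the sampling after `x` reads, in determining `Y`, only
`x`, `W` and what the second party knows. Hence only the joint law of `x` with `W` and the knowledge
of the second party matters; by the conditional independence it is the same whether `x` takes its
natural value or is drawn afresh from its conditional law given `W`
(`lintegral_eq_of_condExp_eq`, `SCM.hybridProb_succ_of_dSep`).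
-/

noncomputable section

namespace CausalImitation

/-! ### Conditional independence of σ-algebras -/

section CondIndep

variable {Ω : Type*} {m C D T A mΩ : MeasurableSpace Ω} {μ : Measure Ω}

theorem integral_mul_condExp [IsProbabilityMeasure μ] (hm : m ≤ mΩ) {f g : Ω → ℝ}
    (hf : StronglyMeasurable[m] f) (hg : Integrable g μ) (hfg : Integrable (f * g) μ) :
    ∫ ω, f ω * (μ[g|m]) ω ∂μ = ∫ ω, f ω * g ω ∂μ := by
  have h := condExp_mul_of_stronglyMeasurable_left hf hfg hg
  rw [← integral_condExp hm (f := fun ω => f ω * g ω)]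
  exact (integral_congr_ae h).symm

/-- The σ-algebras `C` and `D` are conditionally independent given `T`: conditioning on `D` in
addition to `T` does not change the conditional probabilities of the events of `C ⊔ T`. -/
def SigmaCondIndep (C D T : MeasurableSpace Ω) {mΩ : MeasurableSpace Ω} (μ : Measure Ω) : Prop :=
  ∀ s, MeasurableSet[C ⊔ T] s → μ⟦s | D ⊔ T⟧ =ᵐ[μ] μ⟦s | T⟧

/-- Equality of the integrals over all sets of a σ-algebra `C ⊔ T` may be checked on the
π-system of the intersections of a set of `C` with a set of `T`. -/
theorem setIntegral_eq_of_inter (hC : C ≤ mΩ) (hT : T ≤ mΩ)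
    {f g : Ω → ℝ} (hf : Integrable f μ) (hg : Integrable g μ)
    (h : ∀ s t, MeasurableSet[C] s → MeasurableSet[T] t →
      ∫ ω in s ∩ t, f ω ∂μ = ∫ ω in s ∩ t, g ω ∂μ) {r : Set Ω} (hr : MeasurableSet[C ⊔ T] r) :
    ∫ ω in r, f ω ∂μ = ∫ ω in r, g ω ∂μ := by
  have hCT : C ⊔ T ≤ mΩ := sup_le hC hT
  have hgen : C ⊔ T = MeasurableSpace.generateFrom
      {r | ∃ s t, MeasurableSet[C] s ∧ MeasurableSet[T] t ∧ r = s ∩ t} := by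
    apply le_antisymm
    · refine sup_le (fun s hs => ?_) (fun t ht => ?_)
      · exact MeasurableSpace.measurableSet_generateFrom ⟨s, Set.univ, hs, .univ, by simp⟩
      · exact MeasurableSpace.measurableSet_generateFrom ⟨Set.univ, t, .univ, ht, by simp⟩
    · refine MeasurableSpace.generateFrom_le ?_
      rintro _ ⟨s, t, hs, ht, rfl⟩
      exact MeasurableSet.inter (le_sup_left (a := C) _ hs) (le_sup_right (b := T) _ ht)
  have hpi : IsPiSystem {r | ∃ s t, MeasurableSet[C] s ∧ MeasurableSet[T] t ∧ r = s ∩ t} := by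
    rintro _ ⟨s, t, hs, ht, rfl⟩ _ ⟨s', t', hs', ht', rfl⟩ -
    exact ⟨s ∩ s', t ∩ t', hs.inter hs', ht.inter ht', Set.inter_inter_inter_comm _ _ _ _⟩
  have huniv : ∫ ω, f ω ∂μ = ∫ ω, g ω ∂μ := by simpa using h Set.univ Set.univ .univ .univ
  induction r, hr using MeasurableSpace.induction_on_inter hgen hpi with
  | empty => simp
  | basic r hr =>
    obtain ⟨s, t, hs, ht, rfl⟩ := hr
    exact h s t hs ht
  | compl r hr ih =>
    rw [setIntegral_compl (hCT _ hr) hf, setIntegral_compl (hCT _ hr) hg, huniv, ih]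
  | iUnion u hd hu ih =>
    rw [integral_iUnion (fun i => hCT _ (hu i)) hd hf.integrableOn,
      integral_iUnion (fun i => hCT _ (hu i)) hd hg.integrableOn]
    exact tsum_congr ih

theorem condExp_indicator_one_bound (s : Set Ω) :
    ∀ᵐ ω ∂μ, ‖(μ⟦s | m⟧) ω‖ ≤ 1 := by
  have := ae_bdd_abs_condExp_of_ae_bdd_abs (m := m) (μ := μ) (R := (1 : ℝ))
    (f := s.indicator (fun _ => (1 : ℝ))) (by
      refine ae_of_all _ fun ω => ?_
      by_cases h : ω ∈ s <;> simp [h])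
  simpa using this

/-- Conditional independence is symmetric. It is enough to know it for the events of `C`. -/
theorem SigmaCondIndep.symm_of_forall [IsProbabilityMeasure μ] (hC : C ≤ mΩ) (hD : D ≤ mΩ)
    (hT : T ≤ mΩ) (h : ∀ s, MeasurableSet[C] s → μ⟦s | D ⊔ T⟧ =ᵐ[μ] μ⟦s | T⟧) :
    SigmaCondIndep D C T μ := by
  intro b hb
  have hDT : D ⊔ T ≤ mΩ := sup_le hD hT
  have hCT : C ⊔ T ≤ mΩ := sup_le hC hT
  have hint : ∀ {s : Set Ω}, MeasurableSet s → Integrable (s.indicator fun _ => (1 : ℝ)) μ :=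
    fun hs => (integrable_const 1).indicator hs
  symm
  refine ae_eq_condExp_of_forall_setIntegral_eq hCT (hint (hDT _ hb))
    (fun _ _ _ => integrable_condExp.integrableOn) ?_
    (stronglyMeasurable_condExp.mono (le_sup_right : T ≤ C ⊔ T)).aestronglyMeasurable
  intro r hr _
  refine setIntegral_eq_of_inter hC hT integrable_condExp (hint (hDT _ hb)) ?_ hr
  intro s t hs ht
  have hst : MeasurableSet (s ∩ t) := (hC _ hs).inter (hT _ ht)
  set a : Ω → ℝ := s.indicator fun _ => 1 with ha
  set e : Ω → ℝ := t.indicator fun _ => 1 with he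
  set f : Ω → ℝ := b.indicator fun _ => 1 with hf
  have hai : Integrable a μ := hint (hC _ hs)
  have hfi : Integrable f μ := hint (hDT _ hb)
  have hem : StronglyMeasurable[T] e := stronglyMeasurable_one.indicator ht
  have hfm : StronglyMeasurable[D ⊔ T] f := stronglyMeasurable_one.indicator hb
  have hset : ∀ φ : Ω → ℝ, ∫ ω in s ∩ t, φ ω ∂μ = ∫ ω, e ω * φ ω * a ω ∂μ := by
    intro φ
    rw [← integral_indicator hst]
    refine integral_congr_ae (ae_of_all _ fun ω => ?_)
    by_cases h1 : ω ∈ s <;> by_cases h2 : ω ∈ t <;> simp [ha, he, h1, h2]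
  have hea : Integrable (e * a) μ := by
    refine hai.bdd_mul (c := 1) (hem.mono hT).aestronglyMeasurable (ae_of_all _ fun ω => ?_)
    by_cases h : ω ∈ t <;> simp [he, h]
  have hef : Integrable (e * f) μ := by
    refine hfi.bdd_mul (c := 1) (hem.mono hT).aestronglyMeasurable (ae_of_all _ fun ω => ?_)
    by_cases h : ω ∈ t <;> simp [he, h]
  have hebd : ∀ᵐ ω ∂μ, ‖e ω‖ ≤ 1 := ae_of_all _ fun ω => by
    by_cases h : ω ∈ t <;> simp [he, h]
  have hfbd : ∀ᵐ ω ∂μ, ‖f ω‖ ≤ 1 := ae_of_all _ fun ω => by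
    by_cases h : ω ∈ b <;> simp [hf, h]
  have hprod : ∀ {p q : Ω → ℝ}, AEStronglyMeasurable p μ → (∀ᵐ ω ∂μ, ‖p ω‖ ≤ 1) →
      Integrable q μ → Integrable (e * p * q) μ := by
    intro p q hp hpb hq
    refine hq.bdd_mul (c := 1) ((hem.mono hT).aestronglyMeasurable.mul hp) ?_
    filter_upwards [hebd, hpb] with ω h1 h2
    rw [Pi.mul_apply, norm_mul]
    exact mul_le_one₀ h1 (norm_nonneg _) h2
  have hTf : StronglyMeasurable[T] (e * μ[f|T]) := hem.mul stronglyMeasurable_condExp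
  have hTa : StronglyMeasurable[T] (e * μ[a|T]) := hem.mul stronglyMeasurable_condExp
  -- Conditional expectations given `T` are moved from one factor to the other; in between, that of
  -- `a` given `T` is exchanged for the one given `D ⊔ T`, where `e * f` is measurable.
  rw [hset, hset]
  calc ∫ ω, e ω * (μ[f|T]) ω * a ω ∂μ
      = ∫ ω, (e * μ[f|T]) ω * (μ[a|T]) ω ∂μ := by
        rw [integral_mul_condExp hT hTf hai]
        · rfl
        · exact hprod (stronglyMeasurable_condExp.mono hT).aestronglyMeasurable
            (condExp_indicator_one_bound b) hai
    _ = ∫ ω, (e * μ[a|T]) ω * (μ[f|T]) ω ∂μ :=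
        integral_congr_ae (ae_of_all _ fun ω => by simp only [Pi.mul_apply]; ring)
    _ = ∫ ω, (e * μ[a|T]) ω * f ω ∂μ := by
        rw [integral_mul_condExp hT hTa hfi]
        exact hprod (stronglyMeasurable_condExp.mono hT).aestronglyMeasurable
            (condExp_indicator_one_bound s) hfi
    _ = ∫ ω, (e * f) ω * (μ[a|D ⊔ T]) ω ∂μ := by
        refine integral_congr_ae ?_
        filter_upwards [h s hs] with ω hω
        simp only [Pi.mul_apply]
        rw [hω]; ring
    _ = ∫ ω, (e * f) ω * a ω ∂μ := by
        rw [integral_mul_condExp hDT ((hem.mono (le_sup_right : T ≤ D ⊔ T)).mul hfm) hai]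
        exact hprod (hfm.mono hDT).aestronglyMeasurable hfbd hai
    _ = ∫ ω, e ω * f ω * a ω ∂μ := rfl

theorem SigmaCondIndep.of_forall [IsProbabilityMeasure μ] (hC : C ≤ mΩ) (hD : D ≤ mΩ)
    (hT : T ≤ mΩ) (h : ∀ s, MeasurableSet[C] s → μ⟦s | D ⊔ T⟧ =ᵐ[μ] μ⟦s | T⟧) :
    SigmaCondIndep C D T μ :=
  .symm_of_forall hD hC hT fun s hs =>
    SigmaCondIndep.symm_of_forall hC hD hT h s (le_sup_left (a := D) _ hs)

theorem SigmaCondIndep.symm [IsProbabilityMeasure μ] (hC : C ≤ mΩ) (hD : D ≤ mΩ)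
    (hT : T ≤ mΩ) (h : SigmaCondIndep C D T μ) : SigmaCondIndep D C T μ :=
  .symm_of_forall hC hD hT fun s hs => h s (le_sup_left (a := C) _ hs)

/-- Weak union: a σ-algebra `A` known to the holder of `D` and `T` may be added to `T`. -/
theorem SigmaCondIndep.weak_union [IsProbabilityMeasure μ] (hC : C ≤ mΩ) (hD : D ≤ mΩ)
    (hT : T ≤ mΩ) (h : SigmaCondIndep C D T μ) (hA : A ≤ D ⊔ T) :
    SigmaCondIndep C D (T ⊔ A) μ := by
  have hDT : D ⊔ T ≤ mΩ := sup_le hD hT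
  have hTA : T ⊔ A ≤ mΩ := sup_le hT (hA.trans hDT)
  refine .of_forall hC hD hTA fun s hs => ?_
  have h1 := h s (le_sup_left (a := C) _ hs)
  have e : D ⊔ (T ⊔ A) = D ⊔ T :=
    le_antisymm (sup_le le_sup_left (sup_le le_sup_right hA)) (sup_le_sup_left le_sup_left _)
  rw [e]
  have hle : T ⊔ A ≤ D ⊔ T := sup_le le_sup_right hA
  calc μ⟦s | D ⊔ T⟧ =ᵐ[μ] μ⟦s | T⟧ := h1
    _ = μ[μ⟦s | T⟧ | T ⊔ A] :=
      (condExp_of_stronglyMeasurable hTA (stronglyMeasurable_condExp.mono le_sup_left)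
        integrable_condExp).symm
    _ =ᵐ[μ] μ[μ⟦s | D ⊔ T⟧ | T ⊔ A] := condExp_congr_ae h1.symm
    _ =ᵐ[μ] μ⟦s | T ⊔ A⟧ := condExp_condExp_of_le hle hDT

theorem SigmaCondIndep.of_indep [IsProbabilityMeasure μ] (hC : C ≤ mΩ) (hD : D ≤ mΩ)
    (h : Indep C D μ) : SigmaCondIndep C D ⊥ μ := by
  refine .of_forall hC hD bot_le fun s hs => ?_
  rw [sup_bot_eq, condExp_bot]
  exact condExp_indep_eq hC hD (stronglyMeasurable_one.indicator hs) h

/-- If `κ` is the conditional law of `x` given `W`, and `x` is independent, given `W`, of a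
σ-algebra `D` containing `σ(W)` that makes `R` measurable, then replacing `x` by a fresh draw from
`κ` does not change its joint law with `R`. -/
theorem lintegral_eq_of_condExp_eq [IsProbabilityMeasure μ] {α β γ : Type*}
    [MeasurableSpace α] [MeasurableSpace β] [MeasurableSpace γ] {W : Ω → α} {R : Ω → β} {x : Ω → γ} (hx : Measurable x)
    {κ : Kernel α γ} [IsMarkovKernel κ] (hD : D ≤ mΩ)
    (hW : Measurable[D] W) (hR : Measurable[D] R)
    (hκ : μ.map (fun ω => (W ω, x ω)) = μ.map W ⊗ₘ κ)
    (hci : ∀ s, MeasurableSet s →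
      μ⟦x ⁻¹' s | D⟧ =ᵐ[μ] μ⟦x ⁻¹' s | MeasurableSpace.comap W inferInstance⟧)
    {F : β × γ → ENNReal} (hF : Measurable F) :
    ∫⁻ ω, F (R ω, x ω) ∂μ = ∫⁻ ω, ∫⁻ a, F (R ω, a) ∂(κ (W ω)) ∂μ := by
  have hW' : Measurable W := hW.mono hD le_rfl
  have hR' : Measurable R := hR.mono hD le_rfl
  have hcW : MeasurableSpace.comap W inferInstance ≤ mΩ := hW'.comap_le
  have hkm : ∀ {s : Set γ}, MeasurableSet s → Measurable fun ω => κ (W ω) s :=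
    fun hs => (Kernel.measurable_coe κ hs).comp hW'
  have hki : ∀ {s : Set γ}, MeasurableSet s → Integrable (fun ω => (κ (W ω)).real s) μ := by
    intro s hs
    refine Integrable.of_bound (C := 1) (hkm hs).ennreal_toReal.aestronglyMeasurable
      (ae_of_all _ fun ω => ?_)
    rw [Real.norm_of_nonneg measureReal_nonneg]
    exact measureReal_le_one
  have hkset : ∀ {s : Set γ}, MeasurableSet s → ∀ {t : Set Ω}, MeasurableSet t →
      ∫ ω in t, (κ (W ω)).real s ∂μ = (∫⁻ ω in t, κ (W ω) s ∂μ).toReal := by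
    intro s hs t ht
    exact integral_toReal (hkm hs).aemeasurable (ae_of_all _ fun ω => measure_lt_top _ _)
  have hint : ∀ {s : Set γ}, MeasurableSet s →
      Integrable ((x ⁻¹' s).indicator fun _ => (1 : ℝ)) μ :=
    fun hs => (integrable_const 1).indicator (hx hs)
  -- `κ (W ω) s` is a version of the conditional probability of `x ∈ s` given `W`.
  have hk : ∀ s, MeasurableSet s → (fun ω => (κ (W ω)).real s) =ᵐ[μ]
      μ⟦x ⁻¹' s | MeasurableSpace.comap W inferInstance⟧ := by
    intro s hs
    refine ae_eq_condExp_of_forall_setIntegral_eq hcW (hint hs)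
      (fun _ _ _ => (hki hs).integrableOn) ?_ ?_
    · rintro _ ⟨t, ht, rfl⟩ -
      rw [hkset hs (hW' ht), setIntegral_indicator (hx hs), setIntegral_const, smul_eq_mul,
        mul_one, Measure.real]
      congr 1
      have h2 := congrArg (fun ν => ν (t ×ˢ s)) hκ
      rw [Measure.map_apply (hW'.prodMk hx) (ht.prod hs), Measure.compProd_apply_prod ht hs,
        setLIntegral_map ht (Kernel.measurable_coe κ hs) hW'] at h2
      exact h2.symm
    · have : Measurable[MeasurableSpace.comap W inferInstance] fun ω => κ (W ω) s :=
        (Kernel.measurable_coe κ hs).comp (comap_measurable W)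
      exact this.ennreal_toReal.stronglyMeasurable.aestronglyMeasurable
  have hrect : ∀ s, MeasurableSet s → ∀ t, MeasurableSet t →
      μ (R ⁻¹' t ∩ x ⁻¹' s) = ∫⁻ ω in R ⁻¹' t, κ (W ω) s ∂μ := by
    intro s hs t ht
    have h1 : ∫ ω in R ⁻¹' t, (κ (W ω)).real s ∂μ
        = ∫ ω in R ⁻¹' t, (x ⁻¹' s).indicator (fun _ => (1 : ℝ)) ω ∂μ := by
      rw [← setIntegral_condExp hD (hint hs) (hR ht)]
      exact setIntegral_congr_ae (hR' ht)
        (((hk s hs).trans (hci s hs).symm).mono fun ω h _ => h)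
    rw [hkset hs (hR' ht), setIntegral_indicator (hx hs), setIntegral_const, smul_eq_mul,
        mul_one, Measure.real] at h1
    refine ((ENNReal.toReal_eq_toReal_iff' ?_ ?_).1 h1).symm
    · refine ne_of_lt (lt_of_le_of_lt (lintegral_mono fun ω => prob_le_one) ?_)
      simp
    · exact measure_ne_top _ _
  have hmeas : μ.map (fun ω => (R ω, x ω))
      = (μ ⊗ₘ κ.comap W hW').map (fun p => (R p.1, p.2)) := by
    have hp : Measurable fun p : Ω × γ => (R p.1, p.2) :=
      (hR'.comp measurable_fst).prodMk measurable_snd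
    have : IsProbabilityMeasure (μ.map (fun ω => (R ω, x ω))) :=
      Measure.isProbabilityMeasure_map (hR'.prodMk hx).aemeasurable
    refine Measure.ext_prod fun {t s} ht hs => ?_
    rw [Measure.map_apply (hR'.prodMk hx) (ht.prod hs), Measure.map_apply hp (ht.prod hs)]
    have e1 : (fun ω => (R ω, x ω)) ⁻¹' t ×ˢ s = R ⁻¹' t ∩ x ⁻¹' s := rfl
    have e2 : (fun p : Ω × γ => (R p.1, p.2)) ⁻¹' t ×ˢ s = (R ⁻¹' t) ×ˢ s := rfl
    rw [e1, e2, Measure.compProd_apply_prod (hR' ht) hs, hrect s hs t ht]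
    rfl
  have h3 := congrArg (fun ν => ∫⁻ p, F p ∂ν) hmeas
  have hp : Measurable fun p : Ω × γ => (R p.1, p.2) :=
      (hR'.comp measurable_fst).prodMk measurable_snd
  rw [lintegral_map hF (hR'.prodMk hx), lintegral_map hF hp,
    Measure.lintegral_compProd (f := fun p : Ω × γ => F (R p.1, p.2)) (hF.comp hp)] at h3
  exact h3

end CondIndep


/-! ### Active walks and the separation they induce -/

namespace CausalDiagram

variable {V : Type*} {G : CausalDiagram V} {W : Set V} {x y : V}

theorem subset_An : W ⊆ G.An W := fun w hw => ⟨w, hw, .refl⟩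

theorem mem_An_of_dir {a b : V} (h : G.dir a b) (hb : b ∈ G.An W) : a ∈ G.An W := by
  obtain ⟨w, hw, hbw⟩ := hb
  exact ⟨w, hw, .head h hbw⟩

theorem mem_An_of_reflTransGen {a b : V} (h : Relation.ReflTransGen G.dir a b)
    (hb : b ∈ G.An W) : a ∈ G.An W := by
  obtain ⟨w, hw, hbw⟩ := hb
  exact ⟨w, hw, h.trans hbw⟩

/-- Position `i` of the walk with `m` edges of kinds `k` is a collider. -/
def IsCollider (m : ℕ) (k : ℕ → EdgeKind) (i : ℕ) : Prop :=
  0 < i ∧ i < m ∧ (k (i - 1)).HeadAtEnd ∧ (k i).HeadAtStart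

/-- An active walk `v 0, …, v m`: as an active path, but nodes may be repeated. -/
def IsActiveWalk (G : CausalDiagram V) (W : Set V) (m : ℕ) (v : ℕ → V) (k : ℕ → EdgeKind) : Prop :=
  (∀ i < m, G.HasEdge (v i) (k i) (v (i + 1))) ∧
    ∀ i ≤ m, (IsCollider m k i ∧ v i ∈ G.An W) ∨ (¬ IsCollider m k i ∧ v i ∉ W)

/-- A walk that leaves position `i` along a directed edge either keeps following directed edges, or
meets a collider, of which `v i` is then an ancestor. -/
theorem IsActiveWalk.eq_right_or_mem_An {m : ℕ} {v : ℕ → V} {k : ℕ → EdgeKind}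
    (h : G.IsActiveWalk W m v k) {i : ℕ} (hi : k i = .right) (p : ℕ) (hp : i + p < m) :
    v i ∈ G.An W ∨ (k (i + p) = .right ∧ Relation.ReflTransGen G.dir (v i) (v (i + p + 1))) := by
  induction p with
  | zero =>
    have := h.1 i hp
    rw [hi] at this
    exact .inr ⟨hi, .single this⟩
  | succ p ih =>
    rcases ih (by omega) with h1 | ⟨h1, h2⟩
    · exact .inl h1
    · have he := h.1 (i + (p + 1)) hp
      have hs := h.2 (i + (p + 1)) hp.le
      have hk : (k (i + (p + 1) - 1)).HeadAtEnd := by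
        rw [show i + (p + 1) - 1 = i + p by omega, h1]; trivial
      rcases hkk : k (i + (p + 1)) with _ | _ | _
      · rw [hkk] at he
        exact .inr ⟨rfl, h2.tail he⟩
      all_goals
        have hc : IsCollider m k (i + (p + 1)) :=
          ⟨by omega, hp, hk, by rw [hkk]; trivial⟩
        rcases hs with hs | hs
        · exact .inl (mem_An_of_reflTransGen h2 hs.2)
        · exact absurd hc hs.1

/-- Cutting the loop between two visits of the same node leaves an active walk. -/
theorem IsActiveWalk.cut {m : ℕ} {v : ℕ → V} {k : ℕ → EdgeKind} (h : G.IsActiveWalk W m v k)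
    {i j : ℕ} (hij : i < j) (hj : j ≤ m) (hv : v i = v j) :
    G.IsActiveWalk W (m - (j - i)) (fun l => if l ≤ i then v l else v (l + (j - i)))
      (fun l => if l < i then k l else k (l + (j - i))) := by
  refine ⟨fun l hl => ?_, fun l hl => ?_⟩
  · rcases lt_trichotomy l i with hli | rfl | hli
    · simpa [hli, hli.le, Nat.succ_le_of_lt hli] using h.1 l (by omega)
    · have := h.1 j (by omega)
      simp only [le_refl, if_true, lt_irrefl, if_false, Nat.not_succ_le_self,
        show l + (j - l) = j by omega, show l + 1 + (j - l) = j + 1 by omega, hv]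
      exact this
    · have := h.1 (l + (j - i)) (by omega)
      simp only [show ¬ l ≤ i by omega, show ¬ l + 1 ≤ i by omega, show ¬ l < i by omega, if_false,
        show l + 1 + (j - i) = l + (j - i) + 1 by omega]
      exact this
  · rcases lt_trichotomy l i with hli | rfl | hli
    · have hs := h.2 l (by omega)
      have e : IsCollider (m - (j - i)) (fun l => if l < i then k l else k (l + (j - i))) l ↔
          IsCollider m k l := by
        simp only [IsCollider, hli, show l - 1 < i by omega, if_true,
          show l < m - (j - i) by omega, show l < m by omega]
      simpa only [e, hli.le, if_true] using hs
    · have h0 := h.2 l (by omega)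
      have h1 := h.2 j hj
      have e : IsCollider (m - (j - l)) (fun p => if p < l then k p else k (p + (j - l))) l ↔
          0 < l ∧ j < m ∧ (k (l - 1)).HeadAtEnd ∧ (k j).HeadAtStart := by
        simp only [IsCollider, lt_irrefl, if_false, show l + (j - l) = j by omega]
        refine and_congr_right fun hl0 => ?_
        simp only [show l - 1 < l by omega, if_true, show l < m - (j - l) ↔ j < m by omega]
      simp only [e, le_refl, if_true]
      by_cases hc : 0 < l ∧ j < m ∧ (k (l - 1)).HeadAtEnd ∧ (k j).HeadAtStart
      · refine .inl ⟨hc, ?_⟩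
        rcases h0 with h0 | h0
        · exact h0.2
        rcases h1 with h1 | h1
        · rw [hv]; exact h1.2
        -- The walk enters and leaves the loop through tails, so the loop contains a collider.
        have hk : k l = .right := by
          rcases hkk : k l with _ | _ | _
          · rfl
          all_goals exact absurd ⟨hc.1, by omega, hc.2.2.1, by rw [hkk]; trivial⟩ h0.1
        have hk' : k (j - 1) = .left := by
          rcases hkk : k (j - 1) with _ | _ | _
          · exact absurd ⟨by omega, hc.2.1, by rw [hkk]; trivial, hc.2.2.2⟩ h1.1
          · rfl
          · exact absurd ⟨by omega, hc.2.1, by rw [hkk]; trivial, hc.2.2.2⟩ h1.1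
        rcases h.eq_right_or_mem_An hk (j - 1 - l) (by omega) with h2 | h2
        · exact h2
        · rw [show l + (j - 1 - l) = j - 1 by omega, hk'] at h2
          exact absurd h2.1 (by simp)
      · refine .inr ⟨hc, ?_⟩
        rcases h0 with h0 | h0
        · rcases h1 with h1 | h1
          · exact absurd ⟨h0.1.1, h1.1.2.1, h0.1.2.2.1, h1.1.2.2.2⟩ hc
          · rw [hv]; exact h1.2
        · exact h0.2
    · have hs := h.2 (l + (j - i)) (by omega)
      have e : IsCollider (m - (j - i)) (fun l => if l < i then k l else k (l + (j - i))) l ↔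
          IsCollider m k (l + (j - i)) := by
        simp only [IsCollider, show ¬ l < i by omega, show ¬ l - 1 < i by omega, if_false,
          show l - 1 + (j - i) = l + (j - i) - 1 by omega, show 0 < l by omega,
          show 0 < l + (j - i) by omega, show l < m - (j - i) ↔ l + (j - i) < m by omega]
      simpa only [e, show ¬ l ≤ i by omega, if_false] using hs

/-- A shortest active walk is a path. -/
theorem IsActiveWalk.hasActivePath {m : ℕ} {v : ℕ → V} {k : ℕ → EdgeKind}
    (h : G.IsActiveWalk W m v k) : G.HasActivePath W (v 0) (v m) := by
  induction m using Nat.strong_induction_on generalizing v k with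
  | _ m ih =>
    by_cases hinj : Set.InjOn v (Set.Iic m)
    · exact ⟨m, v, k, rfl, rfl, hinj, h.1, h.2⟩
    · obtain ⟨i, j, hij, hj, hv⟩ : ∃ i j, i < j ∧ j ≤ m ∧ v i = v j := by
        simp only [Set.InjOn, not_forall] at hinj
        obtain ⟨a, ha, b, hb, hab, hne⟩ := hinj
        rcases lt_or_gt_of_ne hne with hlt | hlt
        · exact ⟨a, b, hlt, hb, hab⟩
        · exact ⟨b, a, hlt, ha, hab.symm⟩
      have := ih (m - (j - i)) (by omega) (h.cut hij hj hv)
      simp only [Nat.zero_le, if_true] at this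
      convert this using 1
      split_ifs with hle
      · rw [show m - (j - i) = i by omega, hv]; congr 1; omega
      · congr 1; omega

/-- `c` can be reached from `x` by a walk that is active given `W` up to the last node, which is not
inspected. The proposition `h` records whether the walk arrives with an arrowhead at `c`. -/
inductive ActiveReach (G : CausalDiagram V) (W : Set V) (x : V) : Prop → V → Prop
  | start : ActiveReach G W x False x
  | step {h : Prop} {a c : V} {k : EdgeKind} : ActiveReach G W x h a → G.HasEdge a k c →
      ((h ∧ k.HeadAtStart) ∧ a ∈ G.An W ∨ ¬ (h ∧ k.HeadAtStart) ∧ a ∉ W) →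
      ActiveReach G W x k.HeadAtEnd c

theorem ActiveReach.exists_walk {h : Prop} {c : V} (hc : G.ActiveReach W x h c) :
    ∃ (m : ℕ) (v : ℕ → V) (k : ℕ → EdgeKind), v 0 = x ∧ v m = c ∧
      (∀ i < m, G.HasEdge (v i) (k i) (v (i + 1))) ∧
      (∀ i < m, (IsCollider m k i ∧ v i ∈ G.An W) ∨ (¬ IsCollider m k i ∧ v i ∉ W)) ∧
      (h ↔ 0 < m ∧ (k (m - 1)).HeadAtEnd) := by
  induction hc with
  | start => exact ⟨0, fun _ => x, fun _ => .right, rfl, rfl, by simp, by simp, by simp⟩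
  | @step h a c κ hr he hs ih =>
    obtain ⟨m, v, k, h0, hm, hE, hS, hh⟩ := ih
    refine ⟨m + 1, fun i => if i ≤ m then v i else c, fun i => if i < m then k i else κ,
      by simpa using h0, by simp, fun i hi => ?_, fun i hi => ?_, by simp⟩
    · rcases Nat.lt_succ_iff_lt_or_eq.1 hi with hi' | rfl
      · simpa [hi', hi'.le, Nat.succ_le_of_lt hi'] using hE i hi'
      · simpa [hm] using he
    · rcases Nat.lt_succ_iff_lt_or_eq.1 hi with hi' | rfl
      · have e : IsCollider (m + 1) (fun i => if i < m then k i else κ) i ↔ IsCollider m k i := by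
          simp only [IsCollider, hi', show i - 1 < m by omega, if_true, hi]
        simpa only [e, hi'.le, if_true] using hS i hi'
      · have e : IsCollider (i + 1) (fun j => if j < i then k j else κ) i ↔
            h ∧ κ.HeadAtStart := by
          rw [hh, and_assoc]
          simp only [IsCollider, lt_irrefl, if_false, Nat.lt_succ_self, true_and]
          refine and_congr_right fun hi0 => ?_
          simp only [show i - 1 < i by omega, if_true]
        simpa only [e, le_refl, if_true, hm] using hs

theorem ActiveReach.hasActivePath {h : Prop} {c : V} (hc : G.ActiveReach W x h c) (hcW : c ∉ W) :
    G.HasActivePath W x c := by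
  obtain ⟨m, v, k, rfl, rfl, hE, hS, -⟩ := hc.exists_walk
  refine IsActiveWalk.hasActivePath ⟨hE, fun i hi => ?_⟩
  rcases hi.lt_or_eq with hi | rfl
  · exact hS i hi
  · exact .inr ⟨fun h => absurd h.2.1 (lt_irrefl _), hcW⟩

/-- An active walk from `x` may leave `v` against an arrow into `v`. -/
def CanLeaveUp (G : CausalDiagram V) (W : Set V) (x v : V) : Prop :=
  ∃ h, G.ActiveReach W x h v ∧ (h ∧ v ∈ G.An W ∨ ¬ h ∧ v ∉ W)

theorem CanLeaveUp.reach {v c : V} (hv : G.CanLeaveUp W x v) {k : EdgeKind} (hk : k.HeadAtStart)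
    (he : G.HasEdge v k c) : G.ActiveReach W x k.HeadAtEnd c := by
  obtain ⟨h, hr, hh⟩ := hv
  refine hr.step he ?_
  simpa [hk] using hh

theorem ActiveReach.of_reflTransGen {h : Prop} {a b : V} (ha : G.ActiveReach W x h a)
    (hab : Relation.ReflTransGen G.dir a b) (haW : a ∉ G.An W) :
    ∃ h', G.ActiveReach W x h' b := by
  induction hab with
  | refl => exact ⟨h, ha⟩
  | @tail c d hac hcd ih =>
    obtain ⟨h', hc⟩ := ih
    have hcW : c ∉ W := fun hcW => haW ⟨c, hcW, hac⟩
    exact ⟨_, hc.step (k := .right) hcd (.inr ⟨fun h => h.2, hcW⟩)⟩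

theorem ActiveReach.of_reflTransGen_start {a : V} (hax : Relation.ReflTransGen G.dir a x)
    (haW : a ∉ G.An W) : G.ActiveReach W x False a := by
  induction hax using Relation.ReflTransGen.head_induction_on with
  | refl => exact .start
  | @head a c hac hcx ih =>
    have hc : c ∉ G.An W := fun hc => haW (mem_An_of_dir hac hc)
    exact (ih hc).step (k := .left) hac (.inr ⟨fun h => h.1, fun h => hc (subset_An h)⟩)

/-- A reached collider that is not an ancestor of `W` is an ancestor of `x` or of `y`. In the first
case it is also reached from below; in the second case `y` is reached, against the separation. -/
theorem ActiveReach.canLeaveUp (hsep : G.DSep x y W) {h : Prop} {v : V}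
    (hv : G.ActiveReach W x h v) (hA : v ∈ G.An (insert x (insert y W))) (hvW : v ∉ W ∨ h) :
    G.CanLeaveUp W x v := by
  by_cases hvA : v ∈ G.An W
  · by_cases hh : h
    · exact ⟨h, hv, .inl ⟨hh, hvA⟩⟩
    · exact ⟨h, hv, .inr ⟨hh, hvW.resolve_right hh⟩⟩
  · have hvW' : v ∉ W := fun hw => hvA (subset_An hw)
    obtain ⟨w, rfl | rfl | hw, hvw⟩ := hA
    · exact ⟨False, .of_reflTransGen_start hvw hvA, .inr ⟨id, hvW'⟩⟩
    · obtain ⟨h', hy⟩ := hv.of_reflTransGen hvw hvA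
      exact absurd (hy.hasActivePath fun hyW => hvA ⟨_, hyW, hvw⟩) hsep
    · exact absurd ⟨w, hw, hvw⟩ hvA

/-- If `W` separates `x` from `y`, then the ancestors of `x`, `y` and `W` split into two parts, one
with `x` and one with `y`, that communicate only through `W`: the parents outside `W` of a node are
in the part of that node, and no bidirected edge joins the two parts. -/
theorem DSep.exists_split (hsep : G.DSep x y W) (hx : x ∉ W) :
    ∃ E F : Set V, x ∈ E ∧ y ∈ F ∪ W ∧ W ⊆ E ∪ F ∧ Disjoint E F ∧
      (∀ v ∈ E, ∀ p, G.dir p v → p ∈ E ∪ W) ∧ (∀ v ∈ F, ∀ p, G.dir p v → p ∈ F ∪ W) ∧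
      ∀ v ∈ E, ∀ w ∈ F, ¬ G.bi v w := by
  set A := G.An (insert x (insert y W)) with hA
  refine ⟨{v | v ∈ A ∧ G.CanLeaveUp W x v}, {v | v ∈ A ∧ ¬ G.CanLeaveUp W x v},
    ⟨subset_An (by simp), False, .start, .inr ⟨id, hx⟩⟩, ?_, fun w hw => ?_, ?_, ?_, ?_, ?_⟩
  · by_cases hy : y ∈ W
    · exact .inr hy
    · refine .inl ⟨subset_An (by simp), ?_⟩
      rintro ⟨h, hr, -⟩
      exact hsep (hr.hasActivePath hy)
  · have : w ∈ A := subset_An (by simp [hw])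
    by_cases hc : G.CanLeaveUp W x w
    · exact .inl ⟨this, hc⟩
    · exact .inr ⟨this, hc⟩
  · exact Set.disjoint_left.2 fun v h1 h2 => h2.2 h1.2
  · rintro v ⟨hvA, hv⟩ p hp
    by_cases hpW : p ∈ W
    · exact .inr hpW
    · exact .inl ⟨mem_An_of_dir hp hvA, False, hv.reach (k := .left) trivial hp, .inr ⟨id, hpW⟩⟩
  · rintro v ⟨hvA, hv⟩ p hp
    by_cases hpW : p ∈ W
    · exact .inr hpW
    · refine .inl ⟨mem_An_of_dir hp hvA, ?_⟩
      rintro ⟨h, hr, -⟩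
      refine hv (ActiveReach.canLeaveUp hsep (h := True) ?_ hvA (.inr trivial))
      exact hr.step (k := .right) hp (.inr ⟨fun h => h.2, hpW⟩)
  · rintro v ⟨hvA, hv⟩ w ⟨hwA, hw⟩ hvw
    exact hw (ActiveReach.canLeaveUp hsep (h := True)
      (hv.reach (k := .both) trivial hvw) hwA (.inr trivial))

end CausalDiagram

/-! ### Sequential sampling -/

namespace SCM

variable {O L : Type*} {DO : O → Type} [∀ o, MeasurableSpace (DO o)] (M : SCM O L DO)

open Classical in
theorem measurable_setValue (v : O ⊕ L) :
    Measurable fun p : M.State × Dom DO M.DL v =>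
      ((p.1.1, Function.update p.1.2 v p.2) : M.State) := by
  refine (measurable_fst.comp measurable_fst).prodMk (measurable_pi_iff.2 fun w => ?_)
  by_cases h : w = v
  · subst h
    simpa using measurable_snd
  · simp only [Function.update_of_ne h]
    exact (measurable_pi_apply w).comp (measurable_snd.comp measurable_fst)

open Classical in
theorem lintegral_step (v : O ⊕ L) (K : Kernel M.State (Dom DO M.DL v)) [IsMarkovKernel K]
    {g : M.State → ENNReal} (hg : Measurable g) (s : M.State) :
    ∫⁻ r, g r ∂(M.step v K s) = ∫⁻ a, g (s.1, Function.update s.2 v a) ∂(K s) := by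
  have hm := M.measurable_setValue v
  rw [step, Kernel.lintegral_map _ hm _ hg, Kernel.lintegral_id_prod]
  exact hg.comp hm

instance (v : O ⊕ L) (K : Kernel M.State (Dom DO M.DL v)) [IsMarkovKernel K] :
    IsMarkovKernel (M.step v K) := by
  unfold step
  exact Kernel.IsMarkovKernel.map _ (M.measurable_setValue v)

variable {M} in
theorem mechDo_apply_of_mem {X : Finset O} {Z : O → Finset O} (π : Policy DO X Z) {x : O}
    (h : x ∈ X) (s : M.State) :
    M.mechDo π (Sum.inl x) s = π.rule ⟨x, h⟩ (fun z => (s.2 (Sum.inl z) : DO z)) := by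
  exact DFunLike.congr_fun (dif_pos h) s

variable {M} in
theorem mechDo_eq_mech {X : Finset O} {Z : O → Finset O} (π : Policy DO X Z) {v : O ⊕ L}
    (h : ∀ x ∈ X, v ≠ Sum.inl x) : M.mechDo π v = M.mech v := by
  rcases v with x | l
  · exact dif_neg fun hx => h x hx rfl
  · rfl

instance {X : Finset O} {Z : O → Finset O} (π : Policy DO X Z) (v : O ⊕ L) :
    IsMarkovKernel (M.mechDo π v) := by
  by_cases h : ∃ x ∈ X, v = Sum.inl x
  · obtain ⟨x, hx, rfl⟩ := h
    refine ⟨fun s => ?_⟩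
    rw [mechDo_apply_of_mem π hx]
    exact IsMarkovKernel.isProbabilityMeasure (κ := π.rule ⟨x, hx⟩) _
  · rw [mechDo_eq_mech π fun x hx e => h ⟨x, hx, e⟩]
    infer_instance

/-- The expected value of `g` after sampling the nodes of the list by the mechanisms `K`, as a
function of the current state. -/
def expectAfter (K : ∀ v, Kernel M.State (Dom DO M.DL v)) (g : M.State → ENNReal) :
    List (O ⊕ L) → M.State → ENNReal
  | [] => g
  | v :: l => fun s => ∫⁻ r, expectAfter K g l r ∂(M.step v (K v) s)

variable {M}

theorem measurable_expectAfter {K : ∀ v, Kernel M.State (Dom DO M.DL v)}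
    {g : M.State → ENNReal} (hg : Measurable g) (l : List (O ⊕ L)) :
    Measurable (M.expectAfter K g l) := by
  induction l with
  | nil => exact hg
  | cons v l ih => exact ih.lintegral_kernel

/-- An expectation under the law of the sampled state is computed backwards, from the last node. -/
theorem lintegral_foldl_bind {K : ∀ v, Kernel M.State (Dom DO M.DL v)} {g : M.State → ENNReal}
    (hg : Measurable g) (l : List (O ⊕ L)) (μ : Measure M.State) :
    ∫⁻ s, g s ∂(l.foldl (fun (μ : Measure M.State) v => μ.bind (M.step v (K v))) μ) =
      ∫⁻ s, M.expectAfter K g l s ∂μ := by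
  induction l generalizing μ with
  | nil => rfl
  | cons v l ih =>
    rw [List.foldl_cons, ih, Measure.lintegral_bind (Kernel.aemeasurable _)
      (measurable_expectAfter hg l).aemeasurable]
    rfl

/-- The states `s` and `s'` have the same exogenous values on `A` and endogenous values on `N`. -/
def AgreeOn (A : Set M.U) (N : Set (O ⊕ L)) (s s' : M.State) : Prop :=
  (∀ u ∈ A, s.1 u = s'.1 u) ∧ ∀ v ∈ N, s.2 v = s'.2 v

open Classical in
theorem AgreeOn.update {A : Set M.U} {N : Set (O ⊕ L)} {s s' : M.State} (h : AgreeOn A N s s')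
    (v : O ⊕ L) (a : Dom DO M.DL v) :
    AgreeOn A N (s.1, Function.update s.2 v a) (s'.1, Function.update s'.2 v a) := by
  refine ⟨h.1, fun w hw => ?_⟩
  by_cases hwv : w = v
  · subst hwv; simp
  · simpa [Function.update_of_ne hwv] using h.2 w hw

open Classical in
theorem AgreeOn.update_left {A : Set M.U} {N : Set (O ⊕ L)} {s s' : M.State}
    (h : AgreeOn A N s s') {v : O ⊕ L} (hv : v ∉ N) (a : Dom DO M.DL v) :
    AgreeOn A N (s.1, Function.update s.2 v a) s' := by
  refine ⟨h.1, fun w hw => ?_⟩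
  have hwv : w ≠ v := fun e => hv (e ▸ hw)
  simpa [Function.update_of_ne hwv] using h.2 w hw

/-- If the mechanisms of the nodes of `N` in the list read only nodes of `N` and exogenous variables
of `A`, then so does the expected value of a function of such variables. -/
theorem expectAfter_congr {K : ∀ v, Kernel M.State (Dom DO M.DL v)} [∀ v, IsMarkovKernel (K v)]
    {g : M.State → ENNReal} (hg : Measurable g) {A : Set M.U} {N : Set (O ⊕ L)}
    (hgN : ∀ s s', AgreeOn A N s s' → g s = g s') (l : List (O ⊕ L))
    (hK : ∀ v ∈ l, v ∈ N → ∀ s s', AgreeOn A N s s' → K v s = K v s') (s s' : M.State)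
    (hs : AgreeOn A N s s') : M.expectAfter K g l s = M.expectAfter K g l s' := by
  induction l generalizing s s' with
  | nil => exact hgN s s' hs
  | cons v l ih =>
    have ih' := ih fun w hw => hK w (List.mem_cons_of_mem _ hw)
    have hm := measurable_expectAfter (K := K) hg l
    simp only [expectAfter]
    rw [lintegral_step M v (K v) hm, lintegral_step M v (K v) hm]
    by_cases hv : v ∈ N
    · rw [hK v List.mem_cons_self hv s s' hs]
      exact lintegral_congr fun a => ih' _ _ (hs.update v a)
    · -- Whatever value is drawn for `v`, the rest of the sampling does not read it.
      have h1 := fun a => ih' _ _ (hs.update_left hv a)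
      have h2 := fun a => ih' _ _ (AgreeOn.update_left
        (⟨fun _ _ => rfl, fun _ _ => rfl⟩ : AgreeOn A N s' s') hv a)
      simp only [h1, h2, lintegral_const, measure_univ]

/-- Under `do(π)`, the mechanism of a node after `x` reads only its parents in the diagram
manipulated at `x` and, unless the node is an action, its exogenous arguments. -/
theorem mechDo_congr {n : ℕ} {τ : O ⊕ L ≃ Fin n} {G : CausalDiagram (O ⊕ L)} {X : Finset O}
    {Z : O → Finset O} (hM : M.Compatible G) (π : Policy DO X Z) {x : O} {v : O ⊕ L}
    (hv : τ (Sum.inl x) < τ v) {s s' : M.State}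
    (hdir : ∀ w, (G.manipulated τ X Z x).dir w v → s.2 w = s'.2 w)
    (hexo : ¬ IsLaterAction τ X x v → ∀ u ∈ M.exo v, s.1 u = s'.1 u) :
    M.mechDo π v s = M.mechDo π v s' := by
  by_cases h : ∃ x' ∈ X, v = Sum.inl x'
  · obtain ⟨x', hx', rfl⟩ := h
    rw [mechDo_apply_of_mem π hx', mechDo_apply_of_mem π hx']
    congr 1
    funext z
    exact hdir _ (.inr ⟨x', hx', hv, rfl, z, z.2, rfl⟩)
  · have hl : ¬ IsLaterAction τ X x v := fun ⟨x', hx', _, e⟩ => h ⟨x', hx', e⟩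
    rw [mechDo_eq_mech π fun x hx e => h ⟨x, hx, e⟩]
    simp only [mech, Kernel.deterministic_apply]
    congr 3
    · funext w
      exact hdir w (.inl ⟨(hM.1 v w).1 w.2, hl⟩)
    · funext u
      exact hexo hl u u.2

/-- The event `Y ∈ B`, as a function of the state. -/
def eventFun (M : SCM O L DO) (Y : O ⊕ L) (B : Set (Dom DO M.DL Y)) (s : M.State) : ENNReal :=
  B.indicator 1 (s.2 Y)

theorem measurable_eventFun {Y : O ⊕ L} {B : Set (Dom DO M.DL Y)} (hB : MeasurableSet B) :
    Measurable (M.eventFun Y B) :=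
  (measurable_one.indicator hB).comp ((measurable_pi_apply Y).comp measurable_snd)

/-! ### The structural equations -/

variable [∀ o, Nonempty (DO o)] {n : ℕ} (M) (τ : O ⊕ L ≃ Fin n)

open Classical in
/-- The values of the endogenous variables once the first `t` nodes have been assigned, as a
function of the exogenous ones. The other nodes have arbitrary constant values. -/
def prefixValues : ℕ → ((u : M.U) → M.DU u) → (v : O ⊕ L) → Dom DO M.DL v
  | 0, _ => fun _ => Classical.arbitrary _
  | t + 1, ω =>
    if h : t < n then
      Function.update (prefixValues t ω) (τ.symm ⟨t, h⟩)
        (M.f _ (fun w => prefixValues t ω w, fun u => ω u))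
    else prefixValues t ω

/-- The values of the endogenous variables, as a function of the exogenous ones. -/
def values (ω : (u : M.U) → M.DU u) : (v : O ⊕ L) → Dom DO M.DL v := M.prefixValues τ n ω

/-- The nodes in temporal order. -/
def ordered : List (O ⊕ L) := (List.finRange n).map τ.symm

variable {M τ}

open Classical in
theorem prefixValues_succ_of_ne {t : ℕ} {v : O ⊕ L} (hv : (τ v : ℕ) ≠ t)
    (ω : (u : M.U) → M.DU u) : M.prefixValues τ (t + 1) ω v = M.prefixValues τ t ω v := by
  rw [prefixValues]
  split_ifs with h
  · rw [Function.update_of_ne]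
    rintro rfl
    simp at hv
  · rfl

theorem prefixValues_succ_self (v : O ⊕ L) (ω : (u : M.U) → M.DU u) :
    M.prefixValues τ (τ v + 1) ω v =
      M.f v (fun w => M.prefixValues τ (τ v) ω w, fun u => ω u) := by
  rw [prefixValues, dif_pos (τ v).2]
  have e : τ.symm ⟨τ v, (τ v).2⟩ = v := by simp
  generalize τ.symm ⟨τ v, (τ v).2⟩ = v' at e ⊢
  subst e
  simp

theorem prefixValues_of_le {t : ℕ} {v : O ⊕ L} (h : t ≤ τ v) (ω : (u : M.U) → M.DU u) :
    M.prefixValues τ t ω v = Classical.arbitrary _ := by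
  induction t with
  | zero => rfl
  | succ t ih => rw [prefixValues_succ_of_ne (by omega), ih (by omega)]

theorem prefixValues_of_lt {t : ℕ} {v : O ⊕ L} (h : τ v < t) (ω : (u : M.U) → M.DU u) :
    M.prefixValues τ t ω v = M.values τ ω v := by
  have key : ∀ s, (τ v : ℕ) + 1 ≤ s → M.prefixValues τ s ω v = M.prefixValues τ (τ v + 1) ω v := by
    intro s hs
    induction s, hs using Nat.le_induction with
    | base => rfl
    | succ s hs ih => rw [prefixValues_succ_of_ne (by omega), ih]
  rw [values, key t h, key n (τ v).2]

/-- The structural equations. -/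
theorem values_eq_f (hpa : ∀ v, ∀ w ∈ M.pa v, τ w < τ v) (v : O ⊕ L)
    (ω : (u : M.U) → M.DU u) :
    M.values τ ω v = M.f v (fun w => M.values τ ω w, fun u => ω u) := by
  rw [← prefixValues_of_lt (Nat.lt_succ_self (τ v : ℕ)), prefixValues_succ_self]
  congr 2
  funext w
  exact prefixValues_of_lt (hpa v w w.2) ω

theorem measurable_prefixValues (t : ℕ) : Measurable (M.prefixValues τ t) := by
  induction t with
  | zero => exact measurable_const
  | succ t ih =>
    refine measurable_pi_iff.2 fun v => ?_
    by_cases hv : (τ v : ℕ) = t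
    · subst hv
      simp only [prefixValues_succ_self]
      refine (M.measurable_f v).comp (Measurable.prodMk ?_ ?_)
      · exact measurable_pi_iff.2 fun w => (measurable_pi_apply _).comp ih
      · exact measurable_pi_iff.2 fun u => measurable_pi_apply _
    · simp only [prefixValues_succ_of_ne hv]
      exact (measurable_pi_apply v).comp ih

theorem measurable_values : Measurable (M.values τ) := measurable_prefixValues n

open Classical in
theorem bind_step_mech (v : O ⊕ L) :
    (((Measure.pi M.P).map fun ω => ((ω, M.prefixValues τ (τ v) ω) : M.State)).bind
      (M.step v (M.mech v))) =
      (Measure.pi M.P).map fun ω => ((ω, M.prefixValues τ (τ v + 1) ω) : M.State) := by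
  have hm : ∀ t, Measurable fun ω => ((ω, M.prefixValues τ t ω) : M.State) :=
    fun t => measurable_id.prodMk (measurable_prefixValues t)
  refine Measure.ext_of_lintegral _ fun g hg => ?_
  rw [Measure.lintegral_bind (Kernel.aemeasurable _) hg.aemeasurable,
    lintegral_map hg.lintegral_kernel (hm _), lintegral_map hg (hm _)]
  refine lintegral_congr fun ω => ?_
  rw [lintegral_step M v _ hg, mech, Kernel.lintegral_deterministic' (f := fun a => g
    (ω, Function.update (M.prefixValues τ (τ v) ω) v a)) _ (hg.comp ?_)]
  · congr 2
    funext w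
    by_cases hw : w = v
    · subst hw
      rw [prefixValues_succ_self]; simp
    · rw [prefixValues_succ_of_ne, Function.update_of_ne hw]
      exact fun e => hw (τ.injective (Fin.ext e))
  · exact (M.measurable_setValue v).comp ((measurable_const
      (a := ((ω, M.prefixValues τ (τ v) ω) : M.State))).prodMk measurable_id)

/-- Since the mechanisms are deterministic, sampling the first `t` nodes gives the joint law of the
exogenous variables and of the values computed from them. -/
theorem foldl_take_mech (t : ℕ) (ht : t ≤ n) :
    ((ordered τ).take t).foldl (fun (μ : Measure M.State) v => μ.bind (M.step v (M.mech v)))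
      ((Measure.pi M.P).map (fun u => ((u, fun _ => Classical.arbitrary _) : M.State))) =
      (Measure.pi M.P).map fun ω => ((ω, M.prefixValues τ t ω) : M.State) := by
  induction t with
  | zero => rfl
  | succ t ih =>
    have hl : t < (ordered τ).length := by simpa [ordered] using ht
    rw [List.take_succ_eq_append_getElem hl, List.foldl_append, ih (by omega)]
    have e : (ordered τ)[t] = τ.symm ⟨t, ht⟩ := by simp [ordered]
    have := bind_step_mech (M := M) (τ := τ) (τ.symm ⟨t, ht⟩)
    simp only [Equiv.apply_symm_apply] at this
    simp only [e, List.foldl_cons, List.foldl_nil]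
    exact this

theorem law_eq_map_values : M.law τ = (Measure.pi M.P).map (M.values τ) := by
  have h := foldl_take_mech (M := M) (τ := τ) n le_rfl
  rw [List.take_of_length_le (by simp [ordered])] at h
  have h2 : M.law τ = ((Measure.pi M.P).map fun ω =>
      ((ω, M.prefixValues τ n ω) : M.State)).map Prod.snd := by rw [← h]; rfl
  exact h2.trans (Measure.map_map measurable_snd
    (measurable_id.prodMk (measurable_prefixValues n)))

end SCM

theorem measurable_prodMk_pi {Ω ι κ : Type*} {α : ι → Type*} {β : κ → Type*}
    {m : MeasurableSpace Ω} [∀ i, MeasurableSpace (α i)] [∀ j, MeasurableSpace (β j)]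
    {f : Ω → (i : ι) → α i} {g : Ω → (j : κ) → β j} (hf : ∀ i, Measurable fun ω => f ω i)
    (hg : ∀ j, Measurable fun ω => g ω j) : Measurable fun ω => (f ω, g ω) :=
  (measurable_pi_iff.2 hf).prodMk (measurable_pi_iff.2 hg)

namespace SCM

/-! ### Splitting the exogenous variables -/

variable {O L : Type*} {DO : O → Type} [∀ o, MeasurableSpace (DO o)] (M : SCM O L DO) {n : ℕ}

/-- The σ-algebra generated by the exogenous variables in `A`. -/
@[reducible] def exoSigma (A : Set M.U) : MeasurableSpace ((u : M.U) → M.DU u) :=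
  ⨆ u ∈ A, MeasurableSpace.comap (fun ω => ω u) inferInstance

variable {M}

theorem exoSigma_le (A : Set M.U) : M.exoSigma A ≤ MeasurableSpace.pi :=
  iSup₂_le fun u _ => (measurable_pi_apply u).comap_le

theorem measurable_exoSigma {A : Set M.U} {u : M.U} (hu : u ∈ A) :
    Measurable[M.exoSigma A] fun ω : (u : M.U) → M.DU u => ω u :=
  Measurable.of_comap_le
    (le_iSup₂ (f := fun u (_ : u ∈ A) => MeasurableSpace.comap
      (fun ω : (u : M.U) → M.DU u => ω u) inferInstance) u hu)

theorem indep_exoSigma_compl (A : Set M.U) :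
    Indep (M.exoSigma A) (M.exoSigma Aᶜ) (Measure.pi M.P) := by
  have h : iIndepFun (fun u (ω : (u : M.U) → M.DU u) => ω u) (Measure.pi M.P) :=
    iIndepFun_pi (X := fun _ a => a) fun _ => aemeasurable_id
  exact indep_iSup_of_disjoint (fun u => (measurable_pi_apply u).comap_le) h.iIndep
    disjoint_compl_right

variable [∀ o, Nonempty (DO o)]

variable (M) in
/-- The σ-algebra generated by the endogenous variables in `W` among the first `t` ones. -/
@[reducible] def endoSigma (τ : O ⊕ L ≃ Fin n) (W : Set (O ⊕ L)) (t : ℕ) :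
    MeasurableSpace ((u : M.U) → M.DU u) :=
  ⨆ w ∈ {w | w ∈ W ∧ (τ w : ℕ) < t}, MeasurableSpace.comap (fun ω => M.values τ ω w) inferInstance

variable {τ : O ⊕ L ≃ Fin n}

theorem endoSigma_le (W : Set (O ⊕ L)) (t : ℕ) : M.endoSigma τ W t ≤ MeasurableSpace.pi :=
  iSup₂_le fun w _ => ((measurable_pi_apply w).comp measurable_values).comap_le

theorem measurable_endoSigma {W : Set (O ⊕ L)} {t : ℕ} {w : O ⊕ L} (hw : w ∈ W) (ht : τ w < t) :
    Measurable[M.endoSigma τ W t] fun ω => M.values τ ω w :=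
  Measurable.of_comap_le
    (le_iSup₂ (f := fun w (_ : w ∈ {w | w ∈ W ∧ (τ w : ℕ) < t}) => MeasurableSpace.comap
      (fun ω => M.values τ ω w) inferInstance) w ⟨hw, ht⟩)

theorem endoSigma_mono (W : Set (O ⊕ L)) {s t : ℕ} (h : s ≤ t) :
    M.endoSigma τ W s ≤ M.endoSigma τ W t :=
  biSup_mono fun _ hw => ⟨hw.1, hw.2.trans_le h⟩

/-- If the nodes of `E` read only `E`, `W` and the exogenous variables of `A`, then their values
are functions of the latter and of the earlier values of `W`. -/
theorem measurable_values_of_reads (hpa : ∀ v, ∀ w ∈ M.pa v, τ w < τ v) {E W : Set (O ⊕ L)}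
    {A : Set M.U} {b : ℕ} (hE : ∀ v ∈ E, (τ v : ℕ) ≤ b → ∀ w ∈ M.pa v, w ∈ E ∪ W)
    (hA : ∀ v ∈ E, (τ v : ℕ) ≤ b → ∀ u ∈ M.exo v, u ∈ A) (v : O ⊕ L) (hv : v ∈ E)
    (hvb : (τ v : ℕ) ≤ b) :
    Measurable[M.exoSigma A ⊔ M.endoSigma τ W (τ v)] fun ω => M.values τ ω v := by
  induction h : (τ v : ℕ) using Nat.strong_induction_on generalizing v with
  | _ t ih =>
    subst h
    have e : (fun ω => M.values τ ω v) = M.f v ∘ fun ω =>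
        ((fun w : M.pa v => M.values τ ω w), (fun u : M.exo v => ω u)) :=
      funext fun ω => values_eq_f hpa v ω
    rw [e]
    let _ : MeasurableSpace ((u : M.U) → M.DU u) := M.exoSigma A ⊔ M.endoSigma τ W (τ v)
    refine (M.measurable_f v).comp (Measurable.prodMk ?_ ?_)
    · refine measurable_pi_iff.2 fun w => ?_
      have hlt := hpa v w w.2
      rcases hE v hv hvb w w.2 with hw | hw
      · exact (ih _ hlt w hw ((Fin.le_def.1 hlt.le).trans hvb) rfl).mono
          (sup_le_sup_left (endoSigma_mono W hlt.le) _) le_rfl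
      · exact (measurable_endoSigma hw hlt).mono le_sup_right le_rfl
    · exact measurable_pi_iff.2 fun u =>
        (measurable_exoSigma (hA v hv hvb u u.2)).mono le_sup_left le_rfl

theorem endoSigma_zero (W : Set (O ⊕ L)) : M.endoSigma τ W 0 = ⊥ := by
  simp [endoSigma]

theorem endoSigma_succ_of_mem {W : Set (O ⊕ L)} {v : O ⊕ L} (hv : v ∈ W) :
    M.endoSigma τ W (τ v + 1) = M.endoSigma τ W (τ v) ⊔
      MeasurableSpace.comap (fun ω => M.values τ ω v) inferInstance := by
  apply le_antisymm
  · refine iSup₂_le fun w hw => ?_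
    rcases Nat.lt_succ_iff_lt_or_eq.1 hw.2 with h | h
    · exact le_sup_of_le_left (measurable_endoSigma hw.1 h).comap_le
    · obtain rfl : w = v := τ.injective (Fin.ext h)
      exact le_sup_right
  · exact sup_le (endoSigma_mono W (Nat.le_succ _))
      (measurable_endoSigma hv (Nat.lt_succ_self _)).comap_le

theorem endoSigma_succ_of_notMem {W : Set (O ⊕ L)} {v : O ⊕ L} (hv : v ∉ W) :
    M.endoSigma τ W (τ v + 1) = M.endoSigma τ W (τ v) := by
  refine le_antisymm (iSup₂_le fun w hw => ?_) (endoSigma_mono W (Nat.le_succ _))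
  rcases Nat.lt_succ_iff_lt_or_eq.1 hw.2 with h | h
  · exact (measurable_endoSigma hw.1 h).comap_le
  · obtain rfl : w = v := τ.injective (Fin.ext h)
    exact absurd hw.1 hv

/-- Two groups of nodes with private exogenous variables that communicate only by publishing the
values of `W` remain independent given the published values. -/
theorem sigmaCondIndep_of_reads (hpa : ∀ v, ∀ w ∈ M.pa v, τ w < τ v) {E F W : Set (O ⊕ L)}
    {A : Set M.U} {b : ℕ} (hE : ∀ v ∈ E, (τ v : ℕ) ≤ b → ∀ w ∈ M.pa v, w ∈ E ∪ W)
    (hEA : ∀ v ∈ E, (τ v : ℕ) ≤ b → ∀ u ∈ M.exo v, u ∈ A)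
    (hF : ∀ v ∈ F, (τ v : ℕ) ≤ b → ∀ w ∈ M.pa v, w ∈ F ∪ W)
    (hFA : ∀ v ∈ F, (τ v : ℕ) ≤ b → ∀ u ∈ M.exo v, u ∈ Aᶜ) (hW : W ⊆ E ∪ F)
    (t : ℕ) (htb : t ≤ b) (htn : t ≤ n) :
    SigmaCondIndep (M.exoSigma A) (M.exoSigma Aᶜ) (M.endoSigma τ W t) (Measure.pi M.P) := by
  induction t with
  | zero =>
    rw [endoSigma_zero]
    exact .of_indep (exoSigma_le _) (exoSigma_le _) (indep_exoSigma_compl A)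
  | succ t ih =>
    have ih := ih (by omega) (by omega)
    obtain ⟨v, rfl⟩ : ∃ v, t = (τ v : ℕ) := ⟨τ.symm ⟨t, htn⟩, by simp⟩
    by_cases hv : v ∈ W
    · rw [endoSigma_succ_of_mem hv]
      rcases hW hv with hvE | hvF
      · have hm := measurable_values_of_reads hpa hE hEA v hvE (by omega)
        have h2 := (ih.symm (exoSigma_le _) (exoSigma_le _) (endoSigma_le _ _)).weak_union
          (exoSigma_le _) (exoSigma_le _) (endoSigma_le _ _) hm.comap_le
        exact h2.symm (exoSigma_le _) (exoSigma_le _)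
          (sup_le (endoSigma_le _ _) ((measurable_pi_apply v).comp measurable_values).comap_le)
      · have hm := measurable_values_of_reads hpa hF hFA v hvF (by omega)
        exact ih.weak_union (exoSigma_le _) (exoSigma_le _) (endoSigma_le _ _) hm.comap_le
    · rwa [endoSigma_succ_of_notMem hv]

/-! ### Exchanging one mechanism -/

variable {G : CausalDiagram (O ⊕ L)} {X : Finset O} {Z : O → Finset O}

/-- The probability that `Y ∈ B` if the first `t` nodes keep their mechanisms and the later actions
follow the policy. -/
def hybridProb (M : SCM O L DO) (τ : O ⊕ L ≃ Fin n) (π : Policy DO X Z) (Y : O ⊕ L)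
    (B : Set (Dom DO M.DL Y)) (t : ℕ) : ENNReal :=
  ∫⁻ ω, M.expectAfter (M.mechDo π) (M.eventFun Y B) ((ordered τ).drop t)
    (ω, M.prefixValues τ t ω) ∂(Measure.pi M.P)

theorem hybridProb_zero (π : Policy DO X Z) {Y : O ⊕ L} {B : Set (Dom DO M.DL Y)}
    (hB : MeasurableSet B) :
    M.hybridProb τ π Y B 0 = (M.lawDo τ π).map (fun d => d Y) B := by
  have hg := measurable_eventFun hB
  have hY : Measurable fun d : (v : O ⊕ L) → Dom DO M.DL v =>
      B.indicator (1 : Dom DO M.DL Y → ENNReal) (d Y) :=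
    (measurable_one.indicator hB).comp (measurable_pi_apply Y)
  have hm : Measurable fun u : (u : M.U) → M.DU u =>
      ((u, fun _ => Classical.arbitrary _) : M.State) :=
    measurable_id.prodMk measurable_const
  rw [← lintegral_indicator_one hB,
    lintegral_map (measurable_one.indicator hB) (measurable_pi_apply Y), lawDo, sampleLaw,
    lintegral_map hY measurable_snd]
  refine Eq.trans ?_ (lintegral_foldl_bind hg (ordered τ) _).symm
  rw [lintegral_map (measurable_expectAfter hg _) hm]
  rfl

theorem hybridProb_last (π : Policy DO X Z) {Y : O ⊕ L} {B : Set (Dom DO M.DL Y)}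
    (hB : MeasurableSet B) :
    M.hybridProb τ π Y B n = (M.law τ).map (fun d => d Y) B := by
  have hY : Measurable fun d : (v : O ⊕ L) → Dom DO M.DL v =>
      B.indicator (1 : Dom DO M.DL Y → ENNReal) (d Y) :=
    (measurable_one.indicator hB).comp (measurable_pi_apply Y)
  rw [← lintegral_indicator_one hB,
    lintegral_map (measurable_one.indicator hB) (measurable_pi_apply Y), law_eq_map_values,
    lintegral_map hY measurable_values,
    hybridProb, List.drop_of_length_le (by simp [ordered])]
  rfl

open Classical in
theorem prefixValues_succ (v : O ⊕ L) (ω : (u : M.U) → M.DU u) :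
    M.prefixValues τ (τ v + 1) ω =
      Function.update (M.prefixValues τ (τ v) ω) v (M.values τ ω v) := by
  funext w
  by_cases hw : w = v
  · subst hw
    rw [prefixValues_of_lt (Nat.lt_succ_self _)]; simp
  · rw [prefixValues_succ_of_ne, Function.update_of_ne hw]
    exact fun e => hw (τ.injective (Fin.ext e))

open Classical in
/-- The probability at step `τ v`, with the draw of `v` by the policy made explicit. -/
theorem hybridProb_eq (π : Policy DO X Z) {Y : O ⊕ L} {B : Set (Dom DO M.DL Y)}
    (hB : MeasurableSet B) (v : O ⊕ L) :
    M.hybridProb τ π Y B (τ v) = ∫⁻ ω, ∫⁻ a, M.expectAfter (M.mechDo π) (M.eventFun Y B)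
      ((ordered τ).drop (τ v + 1)) (ω, Function.update (M.prefixValues τ (τ v) ω) v a)
      ∂(M.mechDo π v (ω, M.prefixValues τ (τ v) ω)) ∂(Measure.pi M.P) := by
  have hl : (τ v : ℕ) < (ordered τ).length := by simp [ordered]
  have e : (ordered τ)[(τ v : ℕ)] = v := by simp [ordered]
  rw [hybridProb, List.drop_eq_getElem_cons hl, e]
  refine lintegral_congr fun ω => ?_
  exact lintegral_step M v _ (measurable_expectAfter (measurable_eventFun hB) _) _

theorem lt_of_mem_drop_ordered {t : ℕ} {v : O ⊕ L} (h : v ∈ (ordered τ).drop t) : t ≤ τ v := by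
  obtain ⟨i, hi, rfl⟩ := List.mem_iff_getElem.1 h
  simp [ordered]

/-- A node that is not an action has the same mechanism with and without the policy. -/
theorem hybridProb_succ_of_ne (hpa : ∀ v, ∀ w ∈ M.pa v, τ w < τ v) (π : Policy DO X Z) {Y : O ⊕ L}
    {B : Set (Dom DO M.DL Y)} (hB : MeasurableSet B) {v : O ⊕ L} (hv : ∀ x ∈ X, v ≠ Sum.inl x) :
    M.hybridProb τ π Y B (τ v) = M.hybridProb τ π Y B (τ v + 1) := by
  classical
  rw [hybridProb_eq π hB, mechDo_eq_mech π hv, hybridProb]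
  refine lintegral_congr fun ω => ?_
  have hm := (measurable_expectAfter (K := M.mechDo π) (measurable_eventFun hB)
    ((ordered τ).drop (τ v + 1))).comp ((M.measurable_setValue v).comp ((measurable_const
      (a := ((ω, M.prefixValues τ (τ v) ω) : M.State))).prodMk measurable_id))
  rw [mech]
  refine (Kernel.lintegral_deterministic' _ hm).trans ?_
  rw [prefixValues_succ, values_eq_f hpa]
  simp only [Function.comp, id]
  congr 4
  simp only [Prod.mk.injEq, and_true]
  funext w
  exact prefixValues_of_lt (hpa v w w.2) ω

/-- If the values of `x` cannot influence `Y`, then neither can its mechanism. -/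
theorem hybridProb_succ_of_notMem_An (hM : M.Compatible G) (π : Policy DO X Z) {Y : O ⊕ L}
    {B : Set (Dom DO M.DL Y)} (hB : MeasurableSet B) {x : O}
    (hx : (Sum.inl x : O ⊕ L) ∉ (G.manipulated τ X Z x).An {Y}) :
    M.hybridProb τ π Y B (τ (Sum.inl x)) = M.hybridProb τ π Y B (τ (Sum.inl x) + 1) := by
  classical
  rw [hybridProb_eq π hB, hybridProb]
  have hcongr := expectAfter_congr (K := M.mechDo π) (A := Set.univ)
    (N := (G.manipulated τ X Z x).An {Y}) (measurable_eventFun hB)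
    (fun s s' h => by rw [eventFun, eventFun, h.2 Y (CausalDiagram.subset_An rfl)])
    ((ordered τ).drop (τ (Sum.inl x) + 1))
    (fun v hv hvN s s' h => mechDo_congr hM π (x := x) (lt_of_mem_drop_ordered hv)
      (fun w hw => h.2 w (CausalDiagram.mem_An_of_dir hw hvN)) fun _ u _ => h.1 u trivial)
  have hrefl : ∀ s : M.State, AgreeOn Set.univ ((G.manipulated τ X Z x).An {Y}) s s :=
    fun s => ⟨fun _ _ => rfl, fun _ _ => rfl⟩
  refine lintegral_congr fun ω => ?_
  rw [prefixValues_succ]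
  rw [hcongr _ _ ((hrefl (ω, M.prefixValues τ (τ (Sum.inl x)) ω)).update_left hx _)]
  simp only [fun a => hcongr _ _
    ((hrefl (ω, M.prefixValues τ (τ (Sum.inl x)) ω)).update_left hx a), lintegral_const,
    measure_univ, mul_one]

/-- The values of the observed variables, as a function of the exogenous ones. -/
def obsValues (M : SCM O L DO) (τ : O ⊕ L ≃ Fin n) (ω : (u : M.U) → M.DU u) (o : O) : DO o :=
  M.values τ ω (Sum.inl o)

theorem measurable_obsValues : Measurable (M.obsValues τ) :=
  measurable_pi_iff.2 fun o =>
    (measurable_pi_apply (X := Dom DO M.DL) (Sum.inl o)).comp measurable_values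

theorem obsLaw_eq_map_obsValues : M.obsLaw τ = (Measure.pi M.P).map (M.obsValues τ) := by
  have hO : Measurable fun (d : (v : O ⊕ L) → Dom DO M.DL v) (o : O) => (d (Sum.inl o) : DO o) :=
    measurable_pi_iff.2 fun o => measurable_pi_apply (X := Dom DO M.DL) (Sum.inl o)
  rw [obsLaw, law_eq_map_values]
  exact Measure.map_map hO measurable_values

/-- `π` is a conditional law in the model, as it is one under the observational distribution. -/
theorem map_obsValues_eq_compProd (π : Policy DO X Z) (hπ : π.IsConditionalOf (M.obsLaw τ))
    (x : X) :
    (Measure.pi M.P).map (fun ω => ((fun z : Z x => M.obsValues τ ω z), M.obsValues τ ω x)) =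
    (Measure.pi M.P).map (fun ω => fun z : Z x => M.obsValues τ ω z) ⊗ₘ π.rule x := by
  have h := hπ x
  have hz : Measurable fun (d : (o : O) → DO o) (z : Z x) => d z :=
    measurable_pi_iff.2 fun z => measurable_pi_apply _
  rw [obsLaw_eq_map_obsValues,
    Measure.map_map (hz.prodMk (measurable_pi_apply (x : O))) measurable_obsValues,
    Measure.map_map hz measurable_obsValues] at h
  exact h

/-- If the covariates of `x` separate `x` from `Y`, then drawing `x` from its conditional law given
the covariates has the same effect on `Y` as its own mechanism. -/
theorem hybridProb_succ_of_dSep (hτ : G.IsTemporalOrder τ) (hM : M.Compatible G)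
    (hZ : CovariatesBefore τ X Z) (π : Policy DO X Z) (hπ : π.IsConditionalOf (M.obsLaw τ))
    {Y : O ⊕ L} {B : Set (Dom DO M.DL Y)} (hB : MeasurableSet B) {x : O} (hx : x ∈ X)
    (hsep : ((G.manipulated τ X Z x).removeOut (Sum.inl x)).DSep (Sum.inl x) Y
      (Sum.inl '' (Z x : Set O))) :
    M.hybridProb τ π Y B (τ (Sum.inl x)) = M.hybridProb τ π Y B (τ (Sum.inl x) + 1) := by
  classical
  have hpa : ∀ v, ∀ w ∈ M.pa v, τ w < τ v := fun v w hw => hτ _ _ ((hM.1 v w).1 hw)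
  set W : Set (O ⊕ L) := Sum.inl '' (Z x : Set O) with hWdef
  set t : ℕ := ((τ (Sum.inl x) : Fin n) : ℕ) with ht
  have hWlt : ∀ w ∈ W, (τ w : ℕ) < t := by
    rintro _ ⟨z, hz, rfl⟩
    exact hZ x hx z hz
  have hxW : (Sum.inl x : O ⊕ L) ∉ W := fun h => lt_irrefl _ (hWlt _ h)
  obtain ⟨E, F, hxE, hYF, hWEF, hdisj, hE, hF, hbi⟩ := hsep.exists_split hxW
  have hxF : (Sum.inl x : O ⊕ L) ∉ F := fun h => Set.disjoint_left.1 hdisj hxE h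
  have hearly : ∀ v, (τ v : ℕ) ≤ t → ¬ IsLaterAction τ X x v := by
    rintro _ hv ⟨x', -, hlt, rfl⟩
    exact absurd hlt (not_lt.2 hv)
  have hdirE : ∀ v, (τ v : ℕ) ≤ t → ∀ w ∈ M.pa v,
      ((G.manipulated τ X Z x).removeOut (Sum.inl x)).dir w v := by
    intro v hv w hw
    refine ⟨?_, .inl ⟨(hM.1 v w).1 hw, hearly v hv⟩⟩
    rintro rfl
    exact absurd (hpa v _ hw) (not_lt.2 hv)
  -- The private exogenous variables of the part of `x`.
  set A : Set M.U := {u | ∃ v ∈ E, ¬ IsLaterAction τ X x v ∧ u ∈ M.exo v} with hA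
  have hFA : ∀ v ∈ F, ¬ IsLaterAction τ X x v → ∀ u ∈ M.exo v, u ∈ Aᶜ := by
    rintro v hv hvl u hu ⟨v', hv', hvl', hu'⟩
    have hne : v' ≠ v := fun e => Set.disjoint_left.1 hdisj hv' (e ▸ hv)
    exact hbi v' hv' v hv ⟨(hM.2 v' v hne).1 ⟨u, hu', hu⟩, hvl', hvl⟩
  have hEA : ∀ v ∈ E, (τ v : ℕ) ≤ t → ∀ u ∈ M.exo v, u ∈ A :=
    fun v hv hvt u hu => ⟨v, hv, hearly v hvt, hu⟩
  have hE' : ∀ v ∈ E, (τ v : ℕ) ≤ t → ∀ w ∈ M.pa v, w ∈ E ∪ W :=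
    fun v hv hvt w hw => hE v hv w (hdirE v hvt w hw)
  have hF' : ∀ v ∈ F, (τ v : ℕ) ≤ t → ∀ w ∈ M.pa v, w ∈ F ∪ W :=
    fun v hv hvt w hw => hF v hv w (hdirE v hvt w hw)
  have hFA' : ∀ v ∈ F, (τ v : ℕ) ≤ t → ∀ u ∈ M.exo v, u ∈ Aᶜ :=
    fun v hv hvt => hFA v hv (hearly v hvt)
  have hci := sigmaCondIndep_of_reads hpa hE' hEA hF' hFA' hWEF t le_rfl (τ (Sum.inl x)).2.le
  have hxm := measurable_values_of_reads hpa hE' hEA _ hxE le_rfl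
  -- The remaining sampling reads only the part of `Y`, the covariates, and `x`.
  set Φ := M.expectAfter (M.mechDo π) (M.eventFun Y B) ((ordered τ).drop (t + 1)) with hΦ
  have hΦm : Measurable Φ := measurable_expectAfter (measurable_eventFun hB) _
  have hcongr : ∀ s s', AgreeOn Aᶜ (F ∪ W ∪ {Sum.inl x}) s s' → Φ s = Φ s' := by
    refine expectAfter_congr (measurable_eventFun hB)
      (fun s s' h => by rw [eventFun, eventFun, h.2 Y (.inl hYF)]) _ ?_
    intro v hv hvN s s' h
    have hlt : t < τ v := lt_of_mem_drop_ordered hv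
    have hvF : v ∈ F := by
      rcases hvN with (hvF | hvW) | hvx
      · exact hvF
      · exact absurd (hWlt v hvW) (not_lt.2 hlt.le)
      · rw [Set.mem_singleton_iff.1 hvx] at hlt
        exact absurd hlt (lt_irrefl _)
    refine mechDo_congr hM π (x := x) hlt (fun w hw => h.2 w ?_)
      fun hl u hu => h.1 u (hFA v hvF hl u hu)
    by_cases hwx : w = Sum.inl x
    · exact .inr hwx
    · exact .inl (hF v hvF w ⟨hwx, hw⟩)
  -- `R` keeps what the remaining sampling reads, apart from `x`, and masks everything else.
  obtain ⟨ω₀⟩ := nonempty_of_isProbabilityMeasure (Measure.pi M.P)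
  set R : ((u : M.U) → M.DU u) → M.State := fun ω =>
    (fun u => if u ∈ Aᶜ then ω u else ω₀ u,
      fun v => if v ∈ F ∪ W then M.prefixValues τ t ω v else Classical.arbitrary _) with hR
  have hΦR : ∀ ω a, Φ (ω, Function.update (M.prefixValues τ t ω) (Sum.inl x) a) =
      Φ ((R ω).1, Function.update (R ω).2 (Sum.inl x) a) := by
    intro ω a
    refine hcongr _ _ ⟨fun u hu => (if_pos hu).symm, fun v hv => ?_⟩
    by_cases hvx : v = Sum.inl x
    · subst hvx; simp
    · have hv' : v ∈ F ∪ W := hv.resolve_right hvx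
      simp only [Function.update_of_ne hvx]
      exact (if_pos hv').symm
  have hDle : M.exoSigma Aᶜ ⊔ M.endoSigma τ W t ≤ MeasurableSpace.pi :=
    sup_le (exoSigma_le _) (endoSigma_le _ _)
  have hRm : Measurable[M.exoSigma Aᶜ ⊔ M.endoSigma τ W t] R := by
    refine measurable_prodMk_pi (fun u => ?_) (fun v => ?_)
    · by_cases hu : u ∈ Aᶜ
      · simp only [hu, if_true]
        exact (measurable_exoSigma hu).mono le_sup_left le_rfl
      · simp only [hu, if_false]
        exact measurable_const
    · by_cases hv : v ∈ F ∪ W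
      · simp only [hv, if_true]
        rcases lt_or_ge (τ v : ℕ) t with hvt | hvt
        · simp only [prefixValues_of_lt hvt]
          rcases hv with hv | hv
          · exact (measurable_values_of_reads hpa hF' hFA' v hv hvt.le).mono
              (sup_le_sup_left (endoSigma_mono W hvt.le) _) le_rfl
          · exact (measurable_endoSigma hv hvt).mono le_sup_right le_rfl
        · simp only [prefixValues_of_le hvt]
          exact measurable_const
      · simp only [hv, if_false]
        exact measurable_const
  set cov : ((u : M.U) → M.DU u) → (z : Z x) → DO z :=
    fun ω z => M.obsValues τ ω z with hcov
  have hcovm : Measurable[M.endoSigma τ W t] cov := by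
    let _ : MeasurableSpace ((u : M.U) → M.DU u) := M.endoSigma τ W t
    refine measurable_pi_iff.2 fun z => ?_
    have hz : (Sum.inl (z : O) : O ⊕ L) ∈ W := ⟨z, z.2, rfl⟩
    exact measurable_endoSigma hz (hWlt _ hz)
  have hcovs : M.endoSigma τ W t = MeasurableSpace.comap cov inferInstance := by
    refine le_antisymm (iSup₂_le ?_) hcovm.comap_le
    rintro _ ⟨⟨z, hz, rfl⟩, -⟩
    exact Measurable.comap_le
      ((measurable_pi_apply (X := fun z : Z x => DO z) ⟨z, hz⟩).comp (comap_measurable cov))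
  have hxm' : Measurable fun ω => M.obsValues τ ω x :=
    (measurable_pi_apply x).comp measurable_obsValues
  have key := lintegral_eq_of_condExp_eq (W := cov) (R := R)
    (x := fun ω => M.obsValues τ ω x) (κ := π.rule ⟨x, hx⟩) (D := M.exoSigma Aᶜ ⊔ M.endoSigma τ W t)
    (F := fun p => Φ (p.1.1, Function.update p.1.2 (Sum.inl x) p.2)) hxm' hDle
    (hcovm.mono le_sup_right le_rfl) hRm (map_obsValues_eq_compProd π hπ ⟨x, hx⟩)
    (fun s hs => by
      rw [← hcovs]
      exact hci _ (hxm hs))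
    (hΦm.comp (M.measurable_setValue (Sum.inl x)))
  rw [hybridProb_eq π hB, hybridProb]
  have e1 : ∀ ω, M.mechDo π (Sum.inl x) (ω, M.prefixValues τ t ω) = π.rule ⟨x, hx⟩ (cov ω) := by
    intro ω
    rw [mechDo_apply_of_mem π hx]
    congr 1
    funext z
    exact prefixValues_of_lt (hWlt _ ⟨z, z.2, rfl⟩) ω
  calc _ = ∫⁻ ω, ∫⁻ a, Φ ((R ω).1, Function.update (R ω).2 (Sum.inl x) a)
        ∂(π.rule ⟨x, hx⟩ (cov ω)) ∂(Measure.pi M.P) := by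
        refine lintegral_congr fun ω => ?_
        rw [← ht, e1]
        exact lintegral_congr fun a => hΦR ω a
    _ = _ := by
        rw [← key]
        refine lintegral_congr fun ω => ?_
        rw [prefixValues_succ]
        exact (hΦR ω _).symm

/-- Passing from the policy to the natural mechanisms one node at a time, in temporal order, never
changes the law of `Y`. -/
theorem hybridProb_zero_eq_last (hτ : G.IsTemporalOrder τ) (hM : M.Compatible G) {Y : O ⊕ L}
    (hZ : SeqPiBackdoor G τ X Y Z) (π : Policy DO X Z) (hπ : π.IsConditionalOf (M.obsLaw τ))
    {B : Set (Dom DO M.DL Y)} (hB : MeasurableSet B) :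
    M.hybridProb τ π Y B 0 = M.hybridProb τ π Y B n := by
  have hpa : ∀ v, ∀ w ∈ M.pa v, τ w < τ v := fun v w hw => hτ _ _ ((hM.1 v w).1 hw)
  have : ∀ t ≤ n, M.hybridProb τ π Y B 0 = M.hybridProb τ π Y B t := by
    intro t ht
    induction t with
    | zero => rfl
    | succ t ih =>
      rw [ih (by omega)]
      obtain ⟨v, rfl⟩ : ∃ v, t = (τ v : ℕ) := ⟨τ.symm ⟨t, ht⟩, by simp⟩
      by_cases hv : ∃ x ∈ X, v = Sum.inl x
      · obtain ⟨x, hx, rfl⟩ := hv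
        rcases hZ.2 x hx with h | h
        · exact hybridProb_succ_of_dSep hτ hM hZ.1 π hπ hB hx h
        · exact hybridProb_succ_of_notMem_An hM π hB h
      · exact hybridProb_succ_of_ne hpa π hB fun x hx e => hv ⟨x, hx, e⟩
  exact this n le_rfl

end SCM

/-! ### The conditional policy imitates -/

theorem Policy.IsConditionalOf.imitates {O L : Type*} {n : ℕ} {G : CausalDiagram (O ⊕ L)}
    {τ : O ⊕ L ≃ Fin n} (hτ : G.IsTemporalOrder τ) {X : Finset O} {Y : O ⊕ L} {Z : O → Finset O}
    (hZ : SeqPiBackdoor G τ X Y Z) {DO : O → Type} [∀ o, MeasurableSpace (DO o)]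
    [∀ o, Nonempty (DO o)] {ρ : Measure ((o : O) → DO o)} {π : Policy DO X Z}
    (hπ : π.IsConditionalOf ρ) : π.Imitates G τ Y ρ := by
  rintro M hM rfl
  refine Measure.ext fun B hB => ?_
  rw [← SCM.hybridProb_zero π hB, ← SCM.hybridProb_last π hB]
  exact SCM.hybridProb_zero_eq_last hτ hM hZ π hπ hB

theorem exists_isConditionalOf {O : Type*} (X : Finset O) (Z : O → Finset O) {DO : O → Type}
    [∀ o, MeasurableSpace (DO o)] [∀ o, StandardBorelSpace (DO o)] [∀ o, Nonempty (DO o)]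
    (ρ : Measure ((o : O) → DO o)) [IsFiniteMeasure ρ] :
    ∃ π : Policy DO X Z, π.IsConditionalOf ρ :=
  ⟨⟨fun x => condDistrib (fun d => d x) (fun d z => d z) ρ⟩, fun _ =>
    (compProd_map_condDistrib (measurable_pi_apply _).aemeasurable).symm⟩

end CausalImitation

end

theorem mainTheorem1 {O L : Type*} {n : ℕ}
    (G : CausalImitation.CausalDiagram (O ⊕ L)) (τ : O ⊕ L ≃ Fin n) (hτ : G.IsTemporalOrder τ)
    (X : Finset O) (Y : O ⊕ L) (Z : O → Finset O)
    (hZ : CausalImitation.SeqPiBackdoor G τ X Y Z) :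
    CausalImitation.Imitable G τ X Y ∧
    ∀ (DO : O → Type) [∀ o, MeasurableSpace (DO o)] [∀ o, StandardBorelSpace (DO o)]
      [∀ o, Nonempty (DO o)] (ρ : Measure ((o : O) → DO o)) [IsProbabilityMeasure ρ],
      (∃ π : CausalImitation.Policy DO X Z, π.IsConditionalOf ρ) ∧
      ∀ π : CausalImitation.Policy DO X Z, π.IsConditionalOf ρ → π.Imitates G τ Y ρ := by
  refine ⟨fun DO _ _ _ ρ _ => ?_, fun DO _ _ _ ρ _ =>
    ⟨CausalImitation.exists_isConditionalOf X Z ρ, fun π hπ => hπ.imitates hτ hZ⟩⟩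
  obtain ⟨π, hπ⟩ := CausalImitation.exists_isConditionalOf X Z ρ
  exact ⟨Z, π, hZ.1, hπ.imitates hτ hZ⟩
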